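/- Let $\Sigma$ be a compact Riemann surface with canonical bundle $K$. A Higgs bundle $\mathsf W=(W,\phi)$ is a holomorphic vector bundle $W$ with a holomorphic $\phi\in H^0(\Sigma,\mathrm{End}(W)\otimes K)$; homomorphisms of Higgs bundles are holomorphic bundle maps commuting with the Higgs fields, and the dual of $(W,\phi)$ is $(W^*,-{}^t\phi)$. An extension of $\mathsf W_2=(W_2,\phi_2)$ by $\mathsf W_1=(W_1,\phi_1)$ is a short exact sequence $0\to \mathsf W_1\xrightarrow{i}(V,\Phi)\xrightarrow{p}\mathsf W_2\to 0$ of Higgs bundles. Two extensions are strongly equivalent if there is an isomorphism of short exact sequences of Higgs bundles between them which is the identity on $\mathsf W_1$ and on $\mathsf W_2$; they are weakly equivalent if there is any isomorphism of short exact sequences of Higgs bundles between them. The hypercohomology class of an extension is $\delta(V,\Phi)\in\mathbb H^1(\Sigma,\mathsf W_2^*\otimes\mathsf W_1)$, the image of $\mathrm{Id}_{W_2}$ under the connecting homomorphism; here $\mathsf W_2^*\otimes\mathsf W_1$ is the two-term complex $\mathcal O(\mathrm{Hom}(W_2,W_1))\to\mathcal O(\mathrm{Hom}(W_2,W_1)\otimes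 K)$, $s\mapsto \phi_1 s-s\phi_2$. If $h_j$ are local holomorphic splittings of $p$, then $\delta(V,\Phi)$ is represented by the Čech cocycle $(\{h_k-h_j\},\{\Phi h_j-h_j\phi_2\})$. For $\mathsf W_1=\mathsf W$ and $\mathsf W_2=\mathsf W^*$ the complex is $\mathsf W\otimes\mathsf W$, with the subcomplexes $\Lambda^2\mathsf W$ and $\mathrm{Sym}^2\mathsf W$ of skew-symmetric and symmetric tensors; a class belongs to $\mathbb H^1(\Sigma,\Lambda^2\mathsf W)$ (respectively $\mathbb H^1(\Sigma,\mathrm{Sym}^2\mathsf W)$) if it is in the image of that group in $\mathbb H^1(\Sigma,\mathsf W\otimes\mathsf W)$. An orthogonal (respectively symplectic) structure on $(V,\Phi)$ is a holomorphic, fibrewise non-degenerate, symmetric (respectively skew-symmetric) bilinear form $\alpha$ on $V$ with $\alpha(\Phi v,w)=-\alpha(v,\Phi w)$. The subbundle $W\subset V$ is maximally isotropic if $W^{\perp_\alpha}=W$; then $v\mapsto\alpha(v,\cdot)|_W$ is a surjection $V\to W^*$ with kernel $W$. **Proposition.** Let $0\to (W,\phi)\xrightarrow{i}(V,\Phi)\xrightarrow{p}(W^*,-{}^t\phi)\to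 0$ be an extension of Higgs bundles on $\Sigma$. 1. $(V,\Phi)$ has an orthogonal (respectively symplectic) structure $\alpha$ with respect to which $W$ is maximally isotropic and which induces the given projection, $p(v)=\alpha(v,\cdot)|_W$, if and only if the extension is strongly equivalent to an extension whose hypercohomology class belongs to $\mathbb H^1(\Sigma,\Lambda^2\mathsf W)$ (respectively $\mathbb H^1(\Sigma,\mathrm{Sym}^2\mathsf W)$). 2. $(V,\Phi)$ has an orthogonal (respectively symplectic) structure with respect to which $W$ is maximally isotropic if and only if the extension is weakly equivalent to an extension whose hypercohomology class belongs to $\mathbb H^1(\Sigma,\Lambda^2\mathsf W)$ (respectively $\mathbb H^1(\Sigma,\mathrm{Sym}^2\mathsf W)$). 3. If every automorphism of the Higgs bundle $(W,\phi)$ is a scalar (for example, if it is stable), then $(V,\Phi)$ has an orthogonal (respectively symplectic) structure with respect to which $W$ is maximally isotropic if and only if the extension is strongly equivalent to an extension whose hypercohomology class belongs to $\mathbb H^1(\Sigma,\Lambda^2\mathsf W)$ (respectively $\mathbb H^1(\Sigma,\mathrm{Sym}^2\mathsf W)$). -/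

import Mathlib

open scoped Manifold ContDiff Bundle Topology
open TopologicalSpace (Opens)

universe u u' v

noncomputable section

/-- A holomorphic vector bundle of finite rank over the complex manifold `X`, bundled together with
its instances: `Fiber x` are the fibres and `Model` is the model fibre. -/
structure HolBundle (X : Type v) [TopologicalSpace X] [ChartedSpace ℂ X] where
  Model : Type
  [normedModel : NormedAddCommGroup Model]
  [spaceModel : NormedSpace ℂ Model]
  [finiteModel : FiniteDimensional ℂ Model]
  Fiber : X → Type u
  [groupFiber : ∀ x, AddCommGroup (Fiber x)]
  [moduleFiber : ∀ x, Module ℂ (Fiber x)]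
  [topFiber : ∀ x, TopologicalSpace (Fiber x)]
  [topGroupFiber : ∀ x, IsTopologicalAddGroup (Fiber x)]
  [contSMulFiber : ∀ x, ContinuousSMul ℂ (Fiber x)]
  [topTotal : TopologicalSpace (Bundle.TotalSpace Model Fiber)]
  [fiberBundle : FiberBundle Model Fiber]
  [vectorBundle : VectorBundle ℂ Model Fiber]
  [holomorphic : ContMDiffVectorBundle ω Model Fiber 𝓘(ℂ)]

namespace HolBundle

attribute [instance] normedModel spaceModel finiteModel groupFiber moduleFiber topFiber
  topGroupFiber contSMulFiber topTotal fiberBundle vectorBundle holomorphic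

variable {X : Type v} [TopologicalSpace X] [ChartedSpace ℂ X]

/-- The (set-theoretic) section `s` is holomorphic at every point of `U`. -/
def IsHolOn (E : HolBundle.{u} X) (s : ∀ x, E.Fiber x) (U : Set X) : Prop :=
  ContMDiffOn 𝓘(ℂ) (𝓘(ℂ).prod 𝓘(ℂ, E.Model)) ω
    (fun x => Bundle.TotalSpace.mk' E.Model x (s x)) U

/-- The bundle `Hom(A, B)`. -/
abbrev hom (A : HolBundle.{u} X) (B : HolBundle.{u'} X) : HolBundle.{max u u'} X where
  Model := A.Model →L[ℂ] B.Model
  Fiber x := A.Fiber x →L[ℂ] B.Fiber x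

variable (X) in
/-- The trivial line bundle. -/
abbrev trivialLine : HolBundle.{0} X where
  Model := ℂ
  Fiber := Bundle.Trivial X ℂ
  topGroupFiber _ := inferInstanceAs (IsTopologicalAddGroup ℂ)
  contSMulFiber _ := inferInstanceAs (ContinuousSMul ℂ ℂ)

variable (X) in
/-- The holomorphic tangent bundle. -/
abbrev tangent [IsManifold 𝓘(ℂ) ω X] : HolBundle.{0} X where
  Model := ℂ
  Fiber := TangentSpace 𝓘(ℂ)

/-- `E ⊗ K`, realised as `Hom(TX, E)`. -/
abbrev twist [IsManifold 𝓘(ℂ) ω X] (E : HolBundle.{u} X) : HolBundle.{u} X :=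
  (tangent X).hom E

/-- The dual bundle. -/
abbrev dual (E : HolBundle.{u} X) : HolBundle.{u} X := E.hom (trivialLine X)

lemma isHolOn_apply {A : HolBundle.{u} X} {B : HolBundle.{u'} X} {U : Set X}
    {s : ∀ x, A.Fiber x →L[ℂ] B.Fiber x} {v : ∀ x, A.Fiber x}
    (hs : (A.hom B).IsHolOn s U) (hv : A.IsHolOn v U) :
    B.IsHolOn (fun x => s x (v x)) U :=
  ContMDiffOn.clm_bundle_apply (F₁ := A.Model) (F₂ := B.Model) (E₁ := A.Fiber) (E₂ := B.Fiber)
    (b := fun x => x) hs hv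

lemma contMDiffAt_clm {M : Type*} [TopologicalSpace M] [ChartedSpace ℂ M]
    {F G : Type} [NormedAddCommGroup F] [NormedSpace ℂ F] [FiniteDimensional ℂ F]
    [NormedAddCommGroup G] [NormedSpace ℂ G] {f : M → F →L[ℂ] G} {x : M}
    (h : ∀ v, ContMDiffAt 𝓘(ℂ) 𝓘(ℂ, G) ω (fun y => f y v) x) :
    ContMDiffAt 𝓘(ℂ) 𝓘(ℂ, F →L[ℂ] G) ω f x := by
  let d := Module.finrank ℂ F
  have hd : d = Module.finrank ℂ (Fin d → ℂ) := (Module.finrank_fin_fun ℂ).symm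
  let e₁ := ContinuousLinearEquiv.ofFinrankEq hd
  let e₂ := (e₁.arrowCongr (1 : G ≃L[ℂ] G)).trans (ContinuousLinearEquiv.piRing (Fin d))
  have key : ContMDiffAt 𝓘(ℂ) 𝓘(ℂ, Fin d → G) ω (fun y => e₂ (f y)) x := by
    rw [contMDiffAt_pi_space]
    intro i
    exact h _
  have := (e₂.symm.contDiff (n := ω)).contMDiff.contMDiffAt.comp x key
  refine this.congr_of_eventuallyEq (Filter.Eventually.of_forall fun y => ?_)
  simp

lemma isHolOn_of_apply {A : HolBundle.{u} X} {B : HolBundle.{u'} X} {U : Set X} (hU : IsOpen U)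
    {s : ∀ x, A.Fiber x →L[ℂ] B.Fiber x}
    (h : ∀ V : Set X, IsOpen V → V ⊆ U → ∀ v : ∀ x, A.Fiber x, A.IsHolOn v V →
      B.IsHolOn (fun x => s x (v x)) V) :
    (A.hom B).IsHolOn s U := by
  intro x hx
  refine ContMDiffAt.contMDiffWithinAt ?_
  refine (contMDiffAt_hom_bundle (F₁ := A.Model) (F₂ := B.Model) (E₁ := A.Fiber)
    (E₂ := B.Fiber) _).2 ⟨contMDiffAt_id, contMDiffAt_clm fun w => ?_⟩
  let e := trivializationAt A.Model A.Fiber x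
  let e' := trivializationAt B.Model B.Fiber x
  have hxe : x ∈ e.baseSet := FiberBundle.mem_baseSet_trivializationAt' x
  have hxe' : x ∈ e'.baseSet := FiberBundle.mem_baseSet_trivializationAt' x
  have hv : A.IsHolOn (fun y => e.symmL ℂ y w) (U ∩ e.baseSet) := by
    refine ContMDiffOn.mono ?_ Set.inter_subset_right
    rw [e.contMDiffOn_section_baseSet_iff]
    refine (contMDiffOn_const (c := w)).congr fun y hy => ?_
    simp [hy]
  have h2 := h _ (hU.inter e.open_baseSet) Set.inter_subset_left _ hv x ⟨hx, hxe⟩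
  have h3 := (h2.contMDiffAt ((hU.inter e.open_baseSet).mem_nhds ⟨hx, hxe⟩))
  rw [Bundle.contMDiffAt_totalSpace] at h3
  refine h3.2.congr_of_eventuallyEq ?_
  filter_upwards [e.open_baseSet.mem_nhds hxe, e'.open_baseSet.mem_nhds hxe'] with y hy hy'
  rw [ContinuousLinearMap.inCoordinates_eq hy hy']
  simp [e, e', hy]

instance finiteDimensional_fiber (E : HolBundle.{u} X) (x : X) :
    FiniteDimensional ℂ (E.Fiber x) :=
  ((trivializationAt E.Model E.Fiber x).continuousLinearEquivAt ℂ x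
    (FiberBundle.mem_baseSet_trivializationAt' x)).symm.toLinearEquiv.finiteDimensional

instance t2_fiber (E : HolBundle.{u} X) (x : X) : T2Space (E.Fiber x) :=
  ((trivializationAt E.Model E.Fiber x).continuousLinearEquivAt ℂ x
    (FiberBundle.mem_baseSet_trivializationAt' x)).toHomeomorph.symm.t2Space

lemma isHolOn_zero (E : HolBundle.{u} X) (U : Set X) :
    E.IsHolOn (fun _ => 0) U :=
  (Bundle.contMDiff_zeroSection ℂ E.Fiber).contMDiffOn

lemma IsHolOn.sub {E : HolBundle.{u} X} {s t : ∀ x, E.Fiber x} {U : Set X}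
    (hs : E.IsHolOn s U) (ht : E.IsHolOn t U) : E.IsHolOn (fun x => s x - t x) U :=
  ContMDiffOn.sub_section (F := E.Model) (V := E.Fiber) hs ht

/-- The holomorphic sections of `E` over the open set `U`: those functions on `U` which are the
restriction of a set-theoretic section that is holomorphic at every point of `U`. -/
def sections (E : HolBundle.{u} X) (U : Opens X) : Submodule ℂ (∀ x : U, E.Fiber x) where
  carrier := {s | ∃ t : ∀ x, E.Fiber x, E.IsHolOn t U ∧ ∀ x : U, s x = t x}
  zero_mem' := ⟨fun _ => 0, E.isHolOn_zero U, fun _ => rfl⟩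
  add_mem' := by
    rintro _ _ ⟨t, ht, h⟩ ⟨t', ht', h'⟩
    exact ⟨t + t', ContMDiffOn.add_section (F := E.Model) (V := E.Fiber) ht ht',
      fun x => by simp [h, h']⟩
  smul_mem' := by
    rintro c _ ⟨t, ht, h⟩
    exact ⟨c • t, ContMDiffOn.const_smul_section (F := E.Model) (V := E.Fiber) ht,
      fun x => by simp [h]⟩

lemma restrict_mem_sections {E : HolBundle.{u} X} {U V : Opens X} (h : V ≤ U)
    {s : ∀ x : U, E.Fiber x} (hs : s ∈ E.sections U) :
    (fun x : V => s ⟨x, h x.2⟩) ∈ E.sections V := by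
  obtain ⟨t, ht, hst⟩ := hs
  exact ⟨t, ContMDiffOn.mono ht h, fun x => hst ⟨x, h x.2⟩⟩

end HolBundle

/-- A Higgs bundle `(E, Φ)`: a holomorphic vector bundle with a holomorphic section `Φ` of
`End E ⊗ K = Hom(TX, End E)`.  For a tangent vector `t` at `x`, `Φ x t` is the contraction of
`Φ` with `t`. -/
structure HiggsBundle (X : Type v) [TopologicalSpace X] [ChartedSpace ℂ X]
    [IsManifold 𝓘(ℂ) ω X] where
  E : HolBundle.{u} X
  Φ : ∀ x, TangentSpace 𝓘(ℂ) x →L[ℂ] E.Fiber x →L[ℂ] E.Fiber x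
  hol : (E.hom E).twist.IsHolOn Φ Set.univ

namespace HiggsBundle

variable {X : Type v} [TopologicalSpace X] [ChartedSpace ℂ X] [IsManifold 𝓘(ℂ) ω X]

/-- The Higgs field of `Hom(A, B) = A* ⊗ B`: it sends `s` to `Φ_B ∘ s - s ∘ Φ_A`. -/
def homField (A : HiggsBundle.{u} X) (B : HiggsBundle.{u'} X) (x : X) :
    TangentSpace 𝓘(ℂ) x →L[ℂ]
      (A.E.Fiber x →L[ℂ] B.E.Fiber x) →L[ℂ] (A.E.Fiber x →L[ℂ] B.E.Fiber x) :=
  haveI : FiniteDimensional ℂ (A.E.Fiber x →L[ℂ] B.E.Fiber x) :=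
    HolBundle.finiteDimensional_fiber (A.E.hom B.E) x
  haveI : FiniteDimensional ℂ (TangentSpace 𝓘(ℂ) x) :=
    HolBundle.finiteDimensional_fiber (HolBundle.tangent X) x
  haveI : T2Space (TangentSpace 𝓘(ℂ) x) := HolBundle.t2_fiber (HolBundle.tangent X) x
  LinearMap.toContinuousLinearMap
    { toFun := fun t => LinearMap.toContinuousLinearMap
        { toFun := fun s => (B.Φ x t).comp s - s.comp (A.Φ x t)
          map_add' := fun s s' => by ext a; simp; abel
          map_smul' := fun c s => by ext a; simp [smul_sub] }
      map_add' := fun t t' => by ext s a; simp; abel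
      map_smul' := fun c t => by ext s a; simp [smul_sub] }

@[simp]
lemma homField_apply (A : HiggsBundle.{u} X) (B : HiggsBundle.{u'} X) (x : X)
    (t : TangentSpace 𝓘(ℂ) x) (s : A.E.Fiber x →L[ℂ] B.E.Fiber x) (a : A.E.Fiber x) :
    homField A B x t s a = B.Φ x t (s a) - s (A.Φ x t a) := rfl

/-- The Higgs bundle `Hom(A, B) = A* ⊗ B`. -/
abbrev hom (A : HiggsBundle.{u} X) (B : HiggsBundle.{u'} X) : HiggsBundle.{max u u'} X where
  E := A.E.hom B.E
  Φ := homField A B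
  hol := by
    refine HolBundle.isHolOn_of_apply isOpen_univ fun V hV _ t ht => ?_
    refine HolBundle.isHolOn_of_apply hV fun V' hV' hVV' s hs => ?_
    refine HolBundle.isHolOn_of_apply hV' fun V'' hV'' hVV'' a ha => ?_
    have ht' := ContMDiffOn.mono ht (hVV''.trans hVV')
    have hs' := ContMDiffOn.mono hs hVV''
    have hA := HolBundle.isHolOn_apply (ContMDiffOn.mono A.hol (Set.subset_univ V'')) ht'
    have hB := HolBundle.isHolOn_apply (ContMDiffOn.mono B.hol (Set.subset_univ V'')) ht'
    have hsa := HolBundle.isHolOn_apply (A := A.E) (B := B.E) (s := s) hs' ha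
    have hAa := HolBundle.isHolOn_apply (A := A.E) (B := A.E) (s := fun x => A.Φ x (t x)) hA ha
    exact (HolBundle.isHolOn_apply (A := B.E) (B := B.E) (s := fun x => B.Φ x (t x)) hB hsa).sub
      (HolBundle.isHolOn_apply (A := A.E) (B := B.E) (s := s) hs' hAa)

variable (X) in
/-- The neutral Higgs bundle: the trivial line bundle with zero Higgs field. -/
abbrev neutral : HiggsBundle.{0} X where
  E := HolBundle.trivialLine X
  Φ := fun _ => 0
  hol := HolBundle.isHolOn_zero _ _

/-- The dual Higgs bundle `(W*, -ᵗφ)`. -/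
abbrev dual (W : HiggsBundle.{u} X) : HiggsBundle.{u} X := W.hom (neutral X)

lemma dual_apply (W : HiggsBundle.{u} X) (x : X) (t : TangentSpace 𝓘(ℂ) x)
    (ξ : W.dual.E.Fiber x) (w : W.E.Fiber x) : W.dual.Φ x t ξ w = -ξ (W.Φ x t w) :=
  zero_sub (ξ (W.Φ x t w))

/-- A homomorphism of Higgs bundles. -/
structure Hom (A B : HiggsBundle.{u} X) where
  map : ∀ x, A.E.Fiber x →L[ℂ] B.E.Fiber x
  hol : (A.E.hom B.E).IsHolOn map Set.univ
  comm : ∀ x (t : TangentSpace 𝓘(ℂ) x) (a : A.E.Fiber x),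
    map x (A.Φ x t a) = B.Φ x t (map x a)

/-- An isomorphism of Higgs bundles. -/
structure Iso (A B : HiggsBundle.{u} X) where
  toHom : Hom A B
  inv : Hom B A
  left_inv : ∀ x a, inv.map x (toHom.map x a) = a
  right_inv : ∀ x b, toHom.map x (inv.map x b) = b

/-- A family of subspaces of the fibres of `E` preserved by the Higgs field. -/
structure InvariantSub (E : HiggsBundle.{u} X) where
  fiber : ∀ x, Submodule ℂ (E.E.Fiber x)
  invariant : ∀ x (t : TangentSpace 𝓘(ℂ) x), ∀ v ∈ fiber x, E.Φ x t v ∈ fiber x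

end HiggsBundle


/-- An open cover of `X` indexed by the points of `X`, the point `x` lying in the member `x`.
Every open cover has a refinement of this form, and the common refinement of two such covers is
their pointwise intersection. -/
structure PointedCover (X : Type v) [TopologicalSpace X] where
  set : X → Opens X
  mem : ∀ x, x ∈ set x

namespace PointedCover

variable {X : Type v} [TopologicalSpace X]

/-- `U ≤ V` means that `V` refines `U`. -/
instance : Preorder (PointedCover X) where
  le U V := ∀ x, V.set x ≤ U.set x
  le_refl _ _ := le_rfl
  le_trans _ _ _ h h' x := (h' x).trans (h x)

instance : IsDirectedOrder (PointedCover X) where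
  directed U V := ⟨⟨fun x => U.set x ⊓ V.set x, fun x => ⟨U.mem x, V.mem x⟩⟩,
    fun _ => inf_le_left, fun _ => inf_le_right⟩

instance : Nonempty (PointedCover X) := ⟨⟨fun _ => ⊤, fun _ => trivial⟩⟩

open scoped Classical in
instance : DecidableEq (PointedCover X) := inferInstance

end PointedCover

/-- The Higgs field applied to a vector: `v ↦ Φ v ∈ E ⊗ K = Hom(TX, E)`. -/
def HiggsBundle.contract {X : Type v} [TopologicalSpace X] [ChartedSpace ℂ X]
    [IsManifold 𝓘(ℂ) ω X] (E : HiggsBundle.{u} X) (x : X) (v : E.E.Fiber x) :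
    TangentSpace 𝓘(ℂ) x →L[ℂ] E.E.Fiber x :=
  haveI : FiniteDimensional ℂ (TangentSpace 𝓘(ℂ) x) :=
    HolBundle.finiteDimensional_fiber (HolBundle.tangent X) x
  haveI : T2Space (TangentSpace 𝓘(ℂ) x) := HolBundle.t2_fiber (HolBundle.tangent X) x
  LinearMap.toContinuousLinearMap
    { toFun := fun t => E.Φ x t v
      map_add' := fun t t' => by simp
      map_smul' := fun c t => by simp }

namespace HiggsBundle.InvariantSub

variable {X : Type v} [TopologicalSpace X] [ChartedSpace ℂ X] [IsManifold 𝓘(ℂ) ω X]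
  {E : HiggsBundle.{u} X}

variable (E) in
/-- All of `E`. -/
def whole : E.InvariantSub where
  fiber _ := ⊤
  invariant _ _ _ _ := trivial

/-- Degree `0` of the complex `L → L ⊗ K`: the holomorphic sections of `E` with values in `L`. -/
def sec₀ (L : E.InvariantSub) (U : Opens X) : Submodule ℂ (∀ x : U, E.E.Fiber x) where
  carrier := {s | s ∈ E.E.sections U ∧ ∀ x : U, s x ∈ L.fiber x}
  zero_mem' := ⟨zero_mem _, fun _ => zero_mem _⟩
  add_mem' h h' := ⟨add_mem h.1 h'.1, fun x => add_mem (h.2 x) (h'.2 x)⟩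
  smul_mem' c _ h := ⟨Submodule.smul_mem _ c h.1, fun x => Submodule.smul_mem _ c (h.2 x)⟩

/-- Degree `1` of the complex `L → L ⊗ K`: the holomorphic sections of `E ⊗ K` with values in
`L ⊗ K`. -/
def sec₁ (L : E.InvariantSub) (U : Opens X) :
    Submodule ℂ (∀ x : U, TangentSpace 𝓘(ℂ) (x : X) →L[ℂ] E.E.Fiber x) where
  carrier := {s | s ∈ E.E.twist.sections U ∧ ∀ (x : U) (t : TangentSpace 𝓘(ℂ) (x : X)), s x t ∈ L.fiber x}
  zero_mem' := ⟨zero_mem _, fun _ _ => zero_mem _⟩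
  add_mem' h h' := ⟨add_mem h.1 h'.1, fun x t => add_mem (h.2 x t) (h'.2 x t)⟩
  smul_mem' c _ h := ⟨Submodule.smul_mem _ c h.1, fun x t => Submodule.smul_mem _ c (h.2 x t)⟩

instance (L : E.InvariantSub) (U : Opens X) : AddCommGroup (L.sec₀ U) := Submodule.addCommGroup _

instance (L : E.InvariantSub) (U : Opens X) : Module ℂ (L.sec₀ U) := Submodule.module _

instance (L : E.InvariantSub) (U : Opens X) : AddCommGroup (L.sec₁ U) := Submodule.addCommGroup _

instance (L : E.InvariantSub) (U : Opens X) : Module ℂ (L.sec₁ U) := Submodule.module _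

/-- Restriction of sections. -/
def res₀ (L : E.InvariantSub) {U V : Opens X} (h : V ≤ U) : L.sec₀ U →ₗ[ℂ] L.sec₀ V where
  toFun s := ⟨fun x => s.1 ⟨x, h x.2⟩,
    ⟨HolBundle.restrict_mem_sections h s.2.1, fun x => s.2.2 ⟨x, h x.2⟩⟩⟩
  map_add' _ _ := rfl
  map_smul' _ _ := rfl

/-- Restriction of sections. -/
def res₁ (L : E.InvariantSub) {U V : Opens X} (h : V ≤ U) : L.sec₁ U →ₗ[ℂ] L.sec₁ V where
  toFun s := ⟨fun x => s.1 ⟨x, h x.2⟩,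
    ⟨HolBundle.restrict_mem_sections (E := E.E.twist) h s.2.1, fun x t => s.2.2 ⟨x, h x.2⟩ t⟩⟩
  map_add' _ _ := rfl
  map_smul' _ _ := rfl

lemma higgs_mem_sections {U : Opens X} {s : ∀ x : U, E.E.Fiber x} (hs : s ∈ E.E.sections U) :
    (fun x : U => E.contract x (s x)) ∈ E.E.twist.sections U := by
  obtain ⟨t, ht, hst⟩ := hs
  refine ⟨fun x => E.contract x (t x), ?_, fun x => congrArg (E.contract x) (hst x)⟩
  refine HolBundle.isHolOn_of_apply U.isOpen fun V hV hVU τ hτ => ?_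
  have h1 := HolBundle.isHolOn_apply (ContMDiffOn.mono E.hol (Set.subset_univ V)) hτ
  exact HolBundle.isHolOn_apply (A := E.E) (B := E.E) (s := fun x => E.Φ x (τ x)) h1
    (ContMDiffOn.mono ht hVU)

/-- The differential `Φ : L → L ⊗ K`. -/
def higgs (L : E.InvariantSub) (U : Opens X) : L.sec₀ U →ₗ[ℂ] L.sec₁ U where
  toFun s := ⟨fun x => E.contract x (s.1 x), ⟨higgs_mem_sections s.2.1,
    fun x t => L.invariant x t _ (s.2.2 x)⟩⟩
  map_add' s s' := Subtype.ext <| funext fun x => ContinuousLinearMap.ext fun t =>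
    (E.Φ x t).map_add (s.1 x) (s'.1 x)
  map_smul' c s := Subtype.ext <| funext fun x => ContinuousLinearMap.ext fun t =>
    (E.Φ x t).map_smul c (s.1 x)

/-- Čech cochains of total degree `0`. -/
abbrev C₀ (L : E.InvariantSub) (U : PointedCover X) := ∀ i : X, L.sec₀ (U.set i)

instance (L : E.InvariantSub) (U : PointedCover X) : AddCommGroup (L.C₀ U) := Pi.addCommGroup

instance (L : E.InvariantSub) (U : PointedCover X) : Module ℂ (L.C₀ U) := Pi.module _ _ _

/-- Čech cochains of total degree `1`. -/
abbrev C₁ (L : E.InvariantSub) (U : PointedCover X) :=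
  (∀ i j : X, L.sec₀ (U.set i ⊓ U.set j)) × (∀ i : X, L.sec₁ (U.set i))

instance (L : E.InvariantSub) (U : PointedCover X) : AddCommGroup (L.C₁ U) := Prod.instAddCommGroup

instance (L : E.InvariantSub) (U : PointedCover X) : Module ℂ (L.C₁ U) := Prod.instModule

/-- Čech cochains of total degree `2`. -/
abbrev C₂ (L : E.InvariantSub) (U : PointedCover X) :=
  (∀ i j k : X, L.sec₀ (U.set i ⊓ U.set j ⊓ U.set k)) ×
    (∀ i j : X, L.sec₁ (U.set i ⊓ U.set j))

instance (L : E.InvariantSub) (U : PointedCover X) : AddCommGroup (L.C₂ U) := Prod.instAddCommGroup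

instance (L : E.InvariantSub) (U : PointedCover X) : Module ℂ (L.C₂ U) := Prod.instModule

/-- `θ ↦ (θ_j - θ_i, Φ θ_i)`. -/
def d₀ (L : E.InvariantSub) (U : PointedCover X) : L.C₀ U →ₗ[ℂ] L.C₁ U where
  toFun θ := (fun i j => L.res₀ inf_le_right (θ j) - L.res₀ inf_le_left (θ i),
    fun i => L.higgs _ (θ i))
  map_add' θ θ' := by
    refine Prod.ext ?_ ?_
    · funext i j; simp; abel
    · funext i; simp
  map_smul' c θ := by
    refine Prod.ext ?_ ?_
    · funext i j; simp [smul_sub]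
    · funext i; simp

/-- `(b, ψ) ↦ (b_jk - b_ik + b_ij, Φ b_ij - (ψ_j - ψ_i))`. -/
def d₁ (L : E.InvariantSub) (U : PointedCover X) : L.C₁ U →ₗ[ℂ] L.C₂ U where
  toFun z :=
    (fun i j k =>
      L.res₀ (le_inf (inf_le_left.trans inf_le_right) inf_le_right) (z.1 j k)
        - L.res₀ (le_inf (inf_le_left.trans inf_le_left) inf_le_right) (z.1 i k)
        + L.res₀ inf_le_left (z.1 i j),
    fun i j => L.higgs _ (z.1 i j) - (L.res₁ inf_le_right (z.2 j) - L.res₁ inf_le_left (z.2 i)))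
  map_add' z z' := by
    refine Prod.ext ?_ ?_
    · funext i j k; simp; abel
    · funext i j; simp; abel
  map_smul' c z := by
    refine Prod.ext ?_ ?_
    · funext i j k; simp [smul_sub]
    · funext i j; simp [smul_sub]

lemma d₁_d₀ (L : E.InvariantSub) (U : PointedCover X) (θ : L.C₀ U) :
    L.d₁ U (L.d₀ U θ) = 0 := by
  refine Prod.ext ?_ ?_
  · funext i j k
    ext x
    simp [d₁, d₀, res₀]
  · funext i j
    refine Subtype.ext <| funext fun x => ContinuousLinearMap.ext fun t => ?_
    have h := (E.Φ x t).map_sub ((θ j).1 ⟨x, x.2.2⟩) ((θ i).1 ⟨x, x.2.1⟩)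
    exact sub_eq_zero_of_eq h

/-- Čech cocycles of total degree `1`. -/
def Z₁ (L : E.InvariantSub) (U : PointedCover X) : Submodule ℂ (L.C₁ U) := LinearMap.ker (L.d₁ U)

/-- Čech coboundaries of total degree `1`, as a subspace of the cocycles. -/
def B₁ (L : E.InvariantSub) (U : PointedCover X) : Submodule ℂ (L.Z₁ U) :=
  Submodule.comap (L.Z₁ U).subtype (LinearMap.range (L.d₀ U))

instance (L : E.InvariantSub) (U : PointedCover X) : AddCommGroup (L.Z₁ U) :=
  Submodule.addCommGroup _

instance (L : E.InvariantSub) (U : PointedCover X) : Module ℂ (L.Z₁ U) := Submodule.module _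

/-- The first cohomology of the Čech total complex of `L → L ⊗ K` on the cover `U`. -/
def cechH₁ (L : E.InvariantSub) (U : PointedCover X) := L.Z₁ U ⧸ L.B₁ U

instance (L : E.InvariantSub) (U : PointedCover X) : AddCommGroup (L.cechH₁ U) :=
  Submodule.Quotient.addCommGroup _

instance (L : E.InvariantSub) (U : PointedCover X) : Module ℂ (L.cechH₁ U) :=
  Submodule.Quotient.module _

/-- The cohomology class of a cocycle. -/
def mkH₁ (L : E.InvariantSub) (U : PointedCover X) : L.Z₁ U →ₗ[ℂ] L.cechH₁ U :=
  (L.B₁ U).mkQ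

lemma mkH₁_surjective (L : E.InvariantSub) (U : PointedCover X) :
    Function.Surjective (L.mkH₁ U) := (L.B₁ U).mkQ_surjective

/-- Restriction of `1`-cochains to a finer cover. -/
def resC₁ (L : E.InvariantSub) {U V : PointedCover X} (h : U ≤ V) : L.C₁ U →ₗ[ℂ] L.C₁ V where
  toFun z := (fun i j => L.res₀ (inf_le_inf (h i) (h j)) (z.1 i j), fun i => L.res₁ (h i) (z.2 i))
  map_add' _ _ := rfl
  map_smul' _ _ := rfl

/-- Restriction of `1`-cocycles to a finer cover. -/
def resZ₁ (L : E.InvariantSub) {U V : PointedCover X} (h : U ≤ V) :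
    L.Z₁ U →ₗ[ℂ] L.Z₁ V :=
  (L.resC₁ h).restrict fun z hz => by
    rw [Z₁, LinearMap.mem_ker] at hz ⊢
    refine Prod.ext ?_ ?_
    · funext i j k
      ext x
      exact congrFun (congrArg Subtype.val (congrFun (congrFun (congrFun
        (congrArg Prod.fst hz) i) j) k)) ⟨x, ⟨⟨h i x.2.1.1, h j x.2.1.2⟩, h k x.2.2⟩⟩
    · funext i j
      ext1
      funext x
      exact congrFun (congrArg Subtype.val (congrFun (congrFun
        (congrArg Prod.snd hz) i) j)) ⟨x, ⟨h i x.2.1, h j x.2.2⟩⟩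

/-- The refinement map on cohomology. -/
def resH₁ (L : E.InvariantSub) (U V : PointedCover X) (h : U ≤ V) :
    L.cechH₁ U →ₗ[ℂ] L.cechH₁ V :=
  Submodule.mapQ _ _ (L.resZ₁ h) (by
    rintro ⟨z, hz⟩ ⟨θ, hθ⟩
    refine ⟨fun i => L.res₀ (h i) (θ i), ?_⟩
    have hθ' : L.d₀ U θ = z := hθ
    subst hθ'
    rfl)

lemma resH₁_mkH₁ (L : E.InvariantSub) {U V : PointedCover X} (h : U ≤ V) (z : L.Z₁ U) :
    L.resH₁ U V h (L.mkH₁ U z) = L.mkH₁ V (L.resZ₁ h z) := rfl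

instance (L : E.InvariantSub) :
    DirectedSystem L.cechH₁ (fun U V h => L.resH₁ U V h) where
  map_self U z := by
    obtain ⟨z, rfl⟩ := L.mkH₁_surjective U z
    rfl
  map_map U V W h h' z := by
    obtain ⟨z, rfl⟩ := L.mkH₁_surjective _ z
    rfl

/-- The first hypercohomology group `ℍ¹(X, L)` of the two-term complex of sheaves
`Φ : 𝒪(L) → 𝒪(L ⊗ K)`: the direct limit over open covers of the first cohomology of the Čech
total complex. -/
abbrev hyperH₁ (L : E.InvariantSub) :=
  Module.DirectLimit L.cechH₁ L.resH₁

/-- The class in `ℍ¹(X, L)` of a Čech `1`-cocycle. -/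
def classOf (L : E.InvariantSub) (U : PointedCover X) (z : L.Z₁ U) : L.hyperH₁ :=
  Module.DirectLimit.of ℂ _ L.cechH₁ L.resH₁ U (L.mkH₁ U z)

/-- Viewing a `1`-cochain of `L` as a `1`-cochain of `E`. -/
def inclC₁ (L : E.InvariantSub) (U : PointedCover X) : L.C₁ U →ₗ[ℂ] (whole E).C₁ U where
  toFun z := (fun i j => ⟨(z.1 i j).1, ⟨(z.1 i j).2.1, fun _ => trivial⟩⟩,
    fun i => ⟨(z.2 i).1, ⟨(z.2 i).2.1, fun _ _ => trivial⟩⟩)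
  map_add' _ _ := rfl
  map_smul' _ _ := rfl

lemma inclC₁_mem_Z₁ (L : E.InvariantSub) (U : PointedCover X) {z : L.C₁ U} (hz : z ∈ L.Z₁ U) :
    L.inclC₁ U z ∈ (whole E).Z₁ U := by
  rw [Z₁, LinearMap.mem_ker] at hz ⊢
  refine Prod.ext ?_ ?_
  · funext i j k
    refine Subtype.ext <| funext fun x => ?_
    exact congrFun (congrArg Subtype.val (congrFun (congrFun (congrFun
      (congrArg Prod.fst hz) i) j) k)) x
  · funext i j
    refine Subtype.ext <| funext fun x => ?_
    exact congrFun (congrArg Subtype.val (congrFun (congrFun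
      (congrArg Prod.snd hz) i) j)) x

/-- The map on cocycles induced by the inclusion of `L` in `E`. -/
def inclZ₁ (L : E.InvariantSub) (U : PointedCover X) : L.Z₁ U →ₗ[ℂ] (whole E).Z₁ U :=
  (L.inclC₁ U).restrict (p := L.Z₁ U) (q := (whole E).Z₁ U) fun _ hz => L.inclC₁_mem_Z₁ U hz

/-- The map on the first cohomology of a cover induced by the inclusion of `L` in `E`. -/
def inclCechH₁ (L : E.InvariantSub) (U : PointedCover X) :
    L.cechH₁ U →ₗ[ℂ] (whole E).cechH₁ U :=
  Submodule.mapQ _ _ (L.inclZ₁ U) (by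
    rintro ⟨z, hz⟩ ⟨θ, hθ⟩
    refine ⟨fun i => ⟨(θ i).1, ⟨(θ i).2.1, fun _ => trivial⟩⟩, ?_⟩
    have hθ' : L.d₀ U θ = z := hθ
    subst hθ'
    rfl)

lemma inclCechH₁_mkH₁ (L : E.InvariantSub) (U : PointedCover X) (z : L.Z₁ U) :
    L.inclCechH₁ U (L.mkH₁ U z) = (whole E).mkH₁ U (L.inclZ₁ U z) := rfl

lemma inclZ₁_resZ₁ (L : E.InvariantSub) {U V : PointedCover X} (h : U ≤ V) (z : L.Z₁ U) :
    L.inclZ₁ V (L.resZ₁ h z) = (whole E).resZ₁ h (L.inclZ₁ U z) :=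
  Subtype.ext (Prod.ext rfl rfl)

lemma inclCechH₁_resH₁ (L : E.InvariantSub) (U V : PointedCover X) (h : U ≤ V) :
    L.inclCechH₁ V ∘ₗ L.resH₁ U V h = (whole E).resH₁ U V h ∘ₗ L.inclCechH₁ U := by
  refine LinearMap.ext fun z => ?_
  obtain ⟨z, rfl⟩ := L.mkH₁_surjective U z
  rw [LinearMap.comp_apply, LinearMap.comp_apply, resH₁_mkH₁, inclCechH₁_mkH₁, inclCechH₁_mkH₁,
    resH₁_mkH₁, inclZ₁_resZ₁]

/-- The map `ℍ¹(X, L) → ℍ¹(X, E)` induced by the inclusion of complexes. -/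
def inclH₁ (L : E.InvariantSub) : L.hyperH₁ →ₗ[ℂ] (whole E).hyperH₁ :=
  Module.DirectLimit.map L.inclCechH₁ L.inclCechH₁_resH₁

end HiggsBundle.InvariantSub

namespace HiggsBundle

variable {X : Type v} [TopologicalSpace X] [ChartedSpace ℂ X] [IsManifold 𝓘(ℂ) ω X]

/-- An extension `0 → A → V → B → 0` of the Higgs bundle `B` by the Higgs bundle `A`. -/
structure Extension (B A : HiggsBundle.{u} X) where
  V : HiggsBundle.{u} X
  i : Hom A V
  p : Hom V B
  injective : ∀ x, Function.Injective (i.map x)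
  surjective : ∀ x, Function.Surjective (p.map x)
  exact : ∀ x v, p.map x v = 0 ↔ ∃ a, i.map x a = v

namespace Extension

variable {A B : HiggsBundle.{u} X}

/-- Strong equivalence: an isomorphism of extensions inducing the identity on `A` and on `B`. -/
def StronglyEquivalent (𝓔 𝓔' : Extension B A) : Prop :=
  ∃ F : Iso 𝓔.V 𝓔'.V,
    (∀ x a, F.toHom.map x (𝓔.i.map x a) = 𝓔'.i.map x a) ∧
    (∀ x v, 𝓔'.p.map x (F.toHom.map x v) = 𝓔.p.map x v)

/-- Weak equivalence: an isomorphism of short exact sequences of Higgs bundles. -/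
def WeaklyEquivalent (𝓔 𝓔' : Extension B A) : Prop :=
  ∃ (f : Iso A A) (g : Iso B B) (F : Iso 𝓔.V 𝓔'.V),
    (∀ x a, F.toHom.map x (𝓔.i.map x a) = 𝓔'.i.map x (f.toHom.map x a)) ∧
    (∀ x v, 𝓔'.p.map x (F.toHom.map x v) = g.toHom.map x (𝓔.p.map x v))

/-- `c` is the class `δ(V, Φ) ∈ ℍ¹(X, B* ⊗ A)` of the extension, that is, the image of `Id_B` under
the connecting homomorphism `ℍ⁰(X, B* ⊗ B) → ℍ¹(X, B* ⊗ A)`: for some open cover, lift `Id_B` to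
local holomorphic splittings `h_j` of `p`; then `c` is the class of the cocycle
`({h_k - h_j}, {Φ ∘ h_j - h_j ∘ Φ_B})`, which takes values in `A ≅ i(A)`. -/
def IsClass (𝓔 : Extension B A) (c : (InvariantSub.whole (B.hom A)).hyperH₁) : Prop :=
  ∃ (U : PointedCover X) (h : ∀ j : X, (B.E.hom 𝓔.V.E).sections (U.set j))
    (z : (InvariantSub.whole (B.hom A)).Z₁ U),
    (∀ (j : X) (x : U.set j) (b : B.E.Fiber x), 𝓔.p.map x ((h j).1 x b) = b) ∧
    (∀ (j k : X) (x : (U.set j ⊓ U.set k : Opens X)) (b : B.E.Fiber x),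
      𝓔.i.map x ((z.1.1 j k).1 x b) = (h k).1 ⟨x, x.2.2⟩ b - (h j).1 ⟨x, x.2.1⟩ b) ∧
    (∀ (j : X) (x : U.set j) (t : TangentSpace 𝓘(ℂ) (x : X)) (b : B.E.Fiber x),
      𝓔.i.map x ((z.1.2 j).1 x t b) = 𝓔.V.Φ x t ((h j).1 x b) - (h j).1 x (B.Φ x t b)) ∧
    c = InvariantSub.classOf _ U z

end Extension

/-- The two kinds of bilinear forms. -/
inductive FormKind
  | orthogonal
  | symplectic

/-- A form of the given kind satisfies `α(v, w) = sign * α(w, v)`. -/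
def FormKind.sign : FormKind → ℂ
  | .orthogonal => 1
  | .symplectic => -1

/-- A structure of orthogonal (respectively symplectic) Higgs bundle on `(V, Φ)`: a holomorphic,
fibrewise non-degenerate, symmetric (respectively skew-symmetric) bilinear form on `V` for which
`Φ` is skew-symmetric. -/
structure FormStructure (k : FormKind) (V : HiggsBundle.{u} X) where
  form : ∀ x, V.E.Fiber x →L[ℂ] V.E.Fiber x →L[ℂ] ℂ
  hol : (V.E.hom V.E.dual).IsHolOn form Set.univ
  symm : ∀ x v w, form x v w = k.sign * form x w v
  nondegenerate : ∀ x v, (∀ w, form x v w = 0) → v = 0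
  skew : ∀ x (t : TangentSpace 𝓘(ℂ) x) (v w : V.E.Fiber x),
    form x (V.Φ x t v) w = -form x v (V.Φ x t w)

/-- The subbundle `i(A)` is maximally isotropic: it equals its orthogonal complement. -/
def FormStructure.IsMaximallyIsotropic {k : FormKind} {A V : HiggsBundle.{u} X}
    (α : FormStructure k V) (i : Hom A V) : Prop :=
  ∀ x v, (∀ a, α.form x v (i.map x a) = 0) ↔ ∃ a, i.map x a = v

/-- The projection `p : V → W*` of the extension is the one induced by the form, `v ↦ α(v, ·)|_W`. -/
def FormStructure.InducesProjection {k : FormKind} {W : HiggsBundle.{u} X}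
    (𝓔 : Extension W.dual W) (α : FormStructure k 𝓔.V) : Prop :=
  ∀ (x : X) (v : 𝓔.V.E.Fiber x) (w : W.E.Fiber x),
    (𝓔.p.map x v : W.E.Fiber x →L[ℂ] ℂ) w = α.form x v (𝓔.i.map x w)

/-- For `ε = ±1`, the elements `s` of `W ⊗ W = Hom(W*, W)` with `⟨ξ, s η⟩ = ε ⟨η, s ξ⟩`, that is,
the tensors which are multiplied by `ε` when the two factors are exchanged. -/
def tensorPart (W : HiggsBundle.{u} X) (ε : ℂ) : (W.dual.hom W).InvariantSub where
  fiber x :=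
    { carrier := {s : (W.E.Fiber x →L[ℂ] ℂ) →L[ℂ] W.E.Fiber x |
        ∀ ξ η : W.E.Fiber x →L[ℂ] ℂ, ξ (s η) = ε * η (s ξ)}
      zero_mem' := fun ξ η => by simp
      add_mem' := fun {s s'} h h' ξ η => by
        simp only [add_apply, map_add, h ξ η, h' ξ η, mul_add]
      smul_mem' := fun c s h ξ η => by
        simp only [smul_apply, map_smul, h ξ η, smul_eq_mul]; ring }
  invariant x t s hs := by
    have hs' : ∀ ξ η : W.E.Fiber x →L[ℂ] ℂ, ξ (s η) = ε * η (s ξ) := hs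
    intro ξ η
    have key : ∀ ξ η : W.E.Fiber x →L[ℂ] ℂ, ξ ((W.dual.hom W).Φ x t s η) =
        (ξ.comp (W.Φ x t)) (s η) + ξ (s (η.comp (W.Φ x t))) := by
      intro ξ η
      have h1 : W.dual.Φ x t η = -(η.comp (W.Φ x t)) :=
        ContinuousLinearMap.ext fun w => W.dual_apply x t η w
      rw [homField_apply, h1, map_neg, sub_neg_eq_add, map_add]
      rfl
    rw [key, key, hs' (ξ.comp _), hs' ξ]
    ring

/-- `Λ²W`, as the subcomplex of skew-symmetric tensors of `W ⊗ W = Hom(W*, W)`. -/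
def exteriorSquare (W : HiggsBundle.{u} X) : (W.dual.hom W).InvariantSub := W.tensorPart (-1)

/-- `Sym²W`, as the subcomplex of symmetric tensors of `W ⊗ W = Hom(W*, W)`. -/
def symmetricSquare (W : HiggsBundle.{u} X) : (W.dual.hom W).InvariantSub := W.tensorPart 1

/-- `Λ²W` in the orthogonal case, `Sym²W` in the symplectic case. -/
def FormKind.square (k : FormKind) (W : HiggsBundle.{u} X) : (W.dual.hom W).InvariantSub :=
  match k with
  | .orthogonal => W.exteriorSquare
  | .symplectic => W.symmetricSquare

/-- The class of the extension lies in `ℍ¹(X, Λ²W)` (orthogonal case) or `ℍ¹(X, Sym²W)`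
(symplectic case), mapped to `ℍ¹(X, W ⊗ W)` by the inclusion. -/
def Extension.ClassInSquare {W : HiggsBundle.{u} X} (𝓔 : Extension W.dual W) (k : FormKind) :
    Prop :=
  ∃ c : (k.square W).hyperH₁, 𝓔.IsClass ((k.square W).inclH₁ c)

end HiggsBundle

end

noncomputable section

/-! Write `ε` for the sign of the form (`1` orthogonal, `-1` symplectic). The bridge between forms
and hypercohomology is the choice of local splittings `h_j` of `p`, and both sides of the
correspondence reduce to the existence of splittings whose cocycle lies in `Λ²W` (or `Sym²W`).

From a form to a cocycle: if `α` induces `p`, then `α(h_j ξ, i w) = ξ(w)`, and adding half of the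
Gram tensor with a minus sign makes every `h_j` isotropic
(`InducesProjection.exists_isotropic_splitting`). For isotropic splittings, expanding `α(h_k ξ, h_k
η) = 0` and using that `Φ` is skew puts both parts of the cocycle in the required square
(`InducesProjection.takesValuesIn`).

From a cocycle to a form: on `i(W) ⊕ h_j(W*)` take the hyperbolic form given by duality. The
symmetry type of `h_k - h_j` makes these forms agree on overlaps, and that of `Φ h_j - h_j φ₂` makes
`Φ` skew (`Extension.Splitting.exists_formStructure`).

From a cocycle to a class: a class in the image of `ℍ¹(L)` has, on a fine enough cover, a cocycle
differing from an `L`-valued one by a coboundary, and the coboundary is absorbed by changing the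
splittings (`exists_splitting_of_isClass`). Together these give `exists_formStructure_iff`, from
which the strong statement follows by pulling forms back.

Without the condition on `p`, the projection defined by `α` still has kernel `i(W)`, so it is `p`
followed by an automorphism of `W*`; replacing `p` by it gives a weakly equivalent extension. That
automorphism is the transpose of one of `W`; if the latter is a scalar, rescaling `α` removes it. -/

/-- A bilinear map on finite-dimensional spaces, as a continuous bilinear map. -/
def LinearMap.toContinuousBilin {E F G : Type*}
    [AddCommGroup E] [Module ℂ E] [TopologicalSpace E] [IsTopologicalAddGroup E]
    [ContinuousSMul ℂ E] [FiniteDimensional ℂ E] [T2Space E]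
    [AddCommGroup F] [Module ℂ F] [TopologicalSpace F] [IsTopologicalAddGroup F]
    [ContinuousSMul ℂ F] [FiniteDimensional ℂ F] [T2Space F]
    [AddCommGroup G] [Module ℂ G] [TopologicalSpace G] [IsTopologicalAddGroup G]
    [ContinuousSMul ℂ G] (f : E →ₗ[ℂ] F →ₗ[ℂ] G) : E →L[ℂ] F →L[ℂ] G :=
  LinearMap.toContinuousLinearMap
    { toFun := fun e => LinearMap.toContinuousLinearMap (f e)
      map_add' := fun e e' => by ext; simp
      map_smul' := fun c e => by ext; simp }

@[simp]
lemma LinearMap.toContinuousBilin_apply {E F G : Type*}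
    [AddCommGroup E] [Module ℂ E] [TopologicalSpace E] [IsTopologicalAddGroup E]
    [ContinuousSMul ℂ E] [FiniteDimensional ℂ E] [T2Space E]
    [AddCommGroup F] [Module ℂ F] [TopologicalSpace F] [IsTopologicalAddGroup F]
    [ContinuousSMul ℂ F] [FiniteDimensional ℂ F] [T2Space F]
    [AddCommGroup G] [Module ℂ G] [TopologicalSpace G] [IsTopologicalAddGroup G]
    [ContinuousSMul ℂ G] (f : E →ₗ[ℂ] F →ₗ[ℂ] G) (e : E) (x : F) :
    f.toContinuousBilin e x = f e x := rfl

/-! ### Local holomorphic inverses and holomorphy tested by duality -/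

namespace HolBundle

variable {X : Type v} [TopologicalSpace X] [ChartedSpace ℂ X]

lemma IsHolOn.mono {E : HolBundle.{u} X} {s : ∀ x, E.Fiber x} {U V : Set X}
    (hs : E.IsHolOn s U) (h : V ⊆ U) : E.IsHolOn s V :=
  ContMDiffOn.mono hs h

lemma IsHolOn.add {E : HolBundle.{u} X} {s t : ∀ x, E.Fiber x} {U : Set X}
    (hs : E.IsHolOn s U) (ht : E.IsHolOn t U) : E.IsHolOn (fun x => s x + t x) U :=
  ContMDiffOn.add_section (F := E.Model) (V := E.Fiber) hs ht

lemma IsHolOn.const_smul {E : HolBundle.{u} X} {s : ∀ x, E.Fiber x} {U : Set X}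
    (c : ℂ) (hs : E.IsHolOn s U) : E.IsHolOn (fun x => c • s x) U :=
  ContMDiffOn.const_smul_section (F := E.Model) (V := E.Fiber) hs

lemma IsHolOn.congr {E : HolBundle.{u} X} {s t : ∀ x, E.Fiber x} {U : Set X}
    (hs : E.IsHolOn s U) (h : ∀ x ∈ U, t x = s x) : E.IsHolOn t U :=
  ContMDiffOn.congr hs fun x hx => by rw [h x hx]

lemma isHolOn_of_local {E : HolBundle.{u} X} {s : ∀ x, E.Fiber x} {U : Set X}
    (h : ∀ x ∈ U, ∃ N : Set X, IsOpen N ∧ x ∈ N ∧ E.IsHolOn s (U ∩ N)) : E.IsHolOn s U := by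
  intro x hx
  obtain ⟨N, hN, hxN, hs⟩ := h x hx
  exact (hs x ⟨hx, hxN⟩).mono_of_mem_nhdsWithin
    (Filter.inter_mem self_mem_nhdsWithin (mem_nhdsWithin_of_mem_nhds (hN.mem_nhds hxN)))

lemma isHolOn_comp {A : HolBundle.{u} X} {B : HolBundle.{u'} X} {C : HolBundle.{u} X} {U : Set X}
    (hU : IsOpen U) {s : ∀ x, A.Fiber x →L[ℂ] B.Fiber x} {r : ∀ x, B.Fiber x →L[ℂ] C.Fiber x}
    (hr : (B.hom C).IsHolOn r U) (hs : (A.hom B).IsHolOn s U) :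
    (A.hom C).IsHolOn (fun x => (r x).comp (s x)) U :=
  isHolOn_of_apply hU fun _ _ hVU _ ha =>
    isHolOn_apply (A := B) (B := C) (hr.mono hVU)
      (isHolOn_apply (A := A) (B := B) (hs.mono hVU) ha)

/-- A vector of a fibre extends to a holomorphic section near that fibre. -/
lemma exists_isHolOn_through (E : HolBundle.{u} X) {x₀ : X} (v : E.Fiber x₀) :
    ∃ (N : Set X) (s : ∀ x, E.Fiber x), IsOpen N ∧ x₀ ∈ N ∧ E.IsHolOn s N ∧ s x₀ = v := by
  let e := trivializationAt E.Model E.Fiber x₀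
  have hx₀ : x₀ ∈ e.baseSet := FiberBundle.mem_baseSet_trivializationAt' x₀
  refine ⟨e.baseSet, fun y => e.symmL ℂ y (e.continuousLinearMapAt ℂ x₀ v), e.open_baseSet, hx₀,
    ?_, e.symmL_continuousLinearMapAt hx₀ v⟩
  unfold IsHolOn
  rw [e.contMDiffOn_section_baseSet_iff]
  refine (contMDiffOn_const (c := e.continuousLinearMapAt ℂ x₀ v)).congr fun y hy => ?_
  simp [hy]

/-- A holomorphic endomorphism which is the identity at a point is invertible near that point,
with holomorphic inverse. -/
lemma exists_isHolOn_inverse (E : HolBundle.{u} X) {U : Set X} (hU : IsOpen U) {x₀ : X}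
    (hx₀ : x₀ ∈ U) {S : ∀ x, E.Fiber x →L[ℂ] E.Fiber x} (hS : (E.hom E).IsHolOn S U)
    (h1 : S x₀ = ContinuousLinearMap.id ℂ _) :
    ∃ (N : Set X) (R : ∀ x, E.Fiber x →L[ℂ] E.Fiber x), IsOpen N ∧ x₀ ∈ N ∧ N ⊆ U ∧
      (E.hom E).IsHolOn R N ∧ (∀ x ∈ N, ∀ v, R x (S x v) = v) ∧
      ∀ x ∈ N, ∀ v, S x (R x v) = v := by
  let e := trivializationAt E.Model E.Fiber x₀
  have hxe : x₀ ∈ e.baseSet := FiberBundle.mem_baseSet_trivializationAt' x₀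
  let g : X → E.Model →L[ℂ] E.Model := fun y =>
    (e.continuousLinearMapAt ℂ y).comp ((S y).comp (e.symmL ℂ y))
  have hO : IsOpen (U ∩ e.baseSet) := hU.inter e.open_baseSet
  have hg : ∀ y ∈ U ∩ e.baseSet, ContMDiffAt 𝓘(ℂ) 𝓘(ℂ, E.Model →L[ℂ] E.Model) ω g y := by
    intro y hy
    refine contMDiffAt_clm fun w => ?_
    have hv : E.IsHolOn (fun y => e.symmL ℂ y w) (U ∩ e.baseSet) := by
      refine ContMDiffOn.mono ?_ Set.inter_subset_right
      rw [e.contMDiffOn_section_baseSet_iff]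
      refine (contMDiffOn_const (c := w)).congr fun y hy => ?_
      simp [hy]
    have h2 := isHolOn_apply (A := E) (B := E) (hS.mono Set.inter_subset_left) hv
    unfold IsHolOn at h2
    rw [e.contMDiffOn_section_iff hO Set.inter_subset_right] at h2
    refine ((h2 y hy).contMDiffAt (hO.mem_nhds hy)).congr_of_eventuallyEq ?_
    filter_upwards [hO.mem_nhds hy] with z hz
    simp [g, hz.2]
  have hgc : ContinuousOn g (U ∩ e.baseSet) := fun y hy =>
    (hg y hy).continuousAt.continuousWithinAt
  -- In a trivialisation the endomorphism is the operator-valued function `g`. Units are open in the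
  -- Banach algebra of endomorphisms and inversion is analytic there, which gives both the
  -- neighbourhood and the holomorphy of the inverse.
  let N := (U ∩ e.baseSet) ∩ g ⁻¹' {a | IsUnit a}
  have hN : IsOpen N := hgc.isOpen_inter_preimage hO Units.isOpen
  let R : ∀ x, E.Fiber x →L[ℂ] E.Fiber x := fun y =>
    (e.symmL ℂ y).comp ((Ring.inverse (g y)).comp (e.continuousLinearMapAt ℂ y))
  refine ⟨N, R, hN, ⟨⟨hx₀, hxe⟩, ?_⟩, fun y hy => hy.1.1, ?_, ?_, ?_⟩
  · have : g x₀ = 1 := by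
      ext w
      simp [g, h1, hxe]
    simp [this]
  · refine isHolOn_of_apply hN fun V hV hVN a ha => ?_
    have hVe : V ⊆ e.baseSet := fun y hy => (hVN hy).1.2
    unfold IsHolOn at ha ⊢
    rw [e.contMDiffOn_section_iff hV hVe] at ha ⊢
    intro y hy
    obtain ⟨c, hc⟩ := (hVN hy).2
    have hinv : ContMDiffAt 𝓘(ℂ) 𝓘(ℂ, E.Model →L[ℂ] E.Model) ω
        (fun y => Ring.inverse (g y)) y := by
      have h3 := contDiffAt_ringInverse ℂ (n := ω) c
      rw [hc] at h3
      exact h3.contMDiffAt.comp y (hg y (hVN hy).1)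
    refine ((hinv.contMDiffWithinAt (s := V)).clm_apply (ha y hy)).congr (fun z hz => ?_) ?_
    · simp [R, hVe hz]
    · simp [R, hVe hy]
  · intro y hy v
    have h3 : Ring.inverse (g y) * g y = 1 := Ring.inverse_mul_cancel _ hy.2
    have h4 := DFunLike.congr_fun h3 (e.continuousLinearMapAt ℂ y v)
    have h5 : g y (e.continuousLinearMapAt ℂ y v) = e.continuousLinearMapAt ℂ y (S y v) := by
      change e.continuousLinearMapAt ℂ y (S y (e.symmL ℂ y (e.continuousLinearMapAt ℂ y v))) = _
      rw [e.symmL_continuousLinearMapAt hy.1.2]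
    rw [mul_apply_eq_comp, h5] at h4
    change e.symmL ℂ y (Ring.inverse (g y) (e.continuousLinearMapAt ℂ y (S y v))) = v
    rw [h4]
    exact e.symmL_continuousLinearMapAt hy.1.2 v
  · intro y hy v
    have h3 : g y * Ring.inverse (g y) = 1 := Ring.mul_inverse_cancel _ hy.2
    have h4 := DFunLike.congr_fun h3 (e.continuousLinearMapAt ℂ y v)
    have h5 := congrArg (e.symmL ℂ y) h4
    rw [mul_apply_eq_comp, one_apply_eq_self,
      e.symmL_continuousLinearMapAt hy.1.2] at h5
    refine Eq.trans ?_ h5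
    exact (e.symmL_continuousLinearMapAt hy.1.2 _).symm

lemma exists_clm_leftInverse {A : HolBundle.{u} X} {B : HolBundle.{u'} X} {x : X}
    (T : A.Fiber x →L[ℂ] B.Fiber x) (hT : Function.Injective T) :
    ∃ L : B.Fiber x →L[ℂ] A.Fiber x, ∀ a, L (T a) = a := by
  obtain ⟨L, hL⟩ := (T : A.Fiber x →ₗ[ℂ] B.Fiber x).exists_leftInverse_of_injective
    (LinearMap.ker_eq_bot.2 hT)
  exact ⟨LinearMap.toContinuousLinearMap L, fun a => LinearMap.congr_fun hL a⟩

lemma exists_clm_rightInverse {A : HolBundle.{u} X} {B : HolBundle.{u'} X} {x : X}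
    (T : A.Fiber x →L[ℂ] B.Fiber x) (hT : Function.Surjective T) :
    ∃ R : B.Fiber x →L[ℂ] A.Fiber x, ∀ b, T (R b) = b := by
  obtain ⟨R, hR⟩ := (T : A.Fiber x →ₗ[ℂ] B.Fiber x).exists_rightInverse_of_surjective
    (LinearMap.range_eq_top.2 hT)
  exact ⟨LinearMap.toContinuousLinearMap R, fun b => LinearMap.congr_fun hR b⟩

/-- A holomorphic bundle map which is injective at a point has a holomorphic left inverse near that
point. -/
lemma exists_isHolOn_leftInverse {A : HolBundle.{u} X} {B : HolBundle.{u} X} {U : Set X}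
    (hU : IsOpen U) {x₀ : X} (hx₀ : x₀ ∈ U) {T : ∀ x, A.Fiber x →L[ℂ] B.Fiber x}
    (hT : (A.hom B).IsHolOn T U) (hinj : Function.Injective (T x₀)) :
    ∃ (N : Set X) (L : ∀ x, B.Fiber x →L[ℂ] A.Fiber x), IsOpen N ∧ x₀ ∈ N ∧ N ⊆ U ∧
      (B.hom A).IsHolOn L N ∧ ∀ x ∈ N, ∀ a, L x (T x a) = a := by
  obtain ⟨l, hl⟩ := exists_clm_leftInverse (T x₀) hinj
  -- Extend a left inverse at `x₀` to a holomorphic `Λ`. Then `Λ ∘ T` is the identity at `x₀`, hence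
  -- invertible nearby with inverse `R`, and `R ∘ Λ` is a left inverse of `T`.
  obtain ⟨M, Λ, hM, hxM, hΛ, hΛx⟩ := (B.hom A).exists_isHolOn_through l
  have hMU := hM.inter hU
  obtain ⟨N, R, hN, hxN, hNM, hR, hRS, -⟩ := A.exists_isHolOn_inverse hMU ⟨hxM, hx₀⟩
    (isHolOn_comp (A := A) (B := B) (C := A) hMU (hΛ.mono Set.inter_subset_left)
      (hT.mono Set.inter_subset_right))
    (by rw [hΛx]; exact ContinuousLinearMap.ext hl)
  exact ⟨N, fun x => (R x).comp (Λ x), hN, hxN, fun x hx => (hNM hx).2,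
    isHolOn_comp (A := B) (B := A) (C := A) hN hR (hΛ.mono fun x hx => (hNM hx).1), hRS⟩

/-- A holomorphic bundle map which is surjective at a point has a holomorphic right inverse near
that point. -/
lemma exists_isHolOn_rightInverse {A : HolBundle.{u} X} {B : HolBundle.{u} X} {U : Set X}
    (hU : IsOpen U) {x₀ : X} (hx₀ : x₀ ∈ U) {T : ∀ x, A.Fiber x →L[ℂ] B.Fiber x}
    (hT : (A.hom B).IsHolOn T U) (hsurj : Function.Surjective (T x₀)) :
    ∃ (N : Set X) (L : ∀ x, B.Fiber x →L[ℂ] A.Fiber x), IsOpen N ∧ x₀ ∈ N ∧ N ⊆ U ∧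
      (B.hom A).IsHolOn L N ∧ ∀ x ∈ N, ∀ b, T x (L x b) = b := by
  obtain ⟨r, hr⟩ := exists_clm_rightInverse (T x₀) hsurj
  obtain ⟨M, Λ, hM, hxM, hΛ, hΛx⟩ := (B.hom A).exists_isHolOn_through r
  have hMU := hM.inter hU
  obtain ⟨N, R, hN, hxN, hNM, hR, -, hSR⟩ := B.exists_isHolOn_inverse hMU ⟨hxM, hx₀⟩
    (isHolOn_comp (A := B) (B := A) (C := B) hMU (hT.mono Set.inter_subset_right)
      (hΛ.mono Set.inter_subset_left))
    (by rw [hΛx]; exact ContinuousLinearMap.ext hr)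
  exact ⟨N, fun x => (Λ x).comp (R x), hN, hxN, fun x hx => (hNM hx).2,
    isHolOn_comp (A := B) (B := B) (C := A) hN (hΛ.mono fun x hx => (hNM hx).1) hR, hSR⟩

/-- A section is holomorphic if its image under a fibrewise injective holomorphic bundle map is. -/
lemma isHolOn_of_injective_apply {A : HolBundle.{u} X} {B : HolBundle.{u} X} {U : Set X}
    (hU : IsOpen U) {T : ∀ x, A.Fiber x →L[ℂ] B.Fiber x} (hT : (A.hom B).IsHolOn T U)
    (hinj : ∀ x, Function.Injective (T x)) {a : ∀ x, A.Fiber x}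
    (h : B.IsHolOn (fun x => T x (a x)) U) : A.IsHolOn a U := by
  refine isHolOn_of_local fun x hx => ?_
  obtain ⟨N, L, hN, hxN, hNU, hL, hLT⟩ := exists_isHolOn_leftInverse hU hx hT (hinj x)
  refine ⟨N, hN, hxN, ?_⟩
  refine (isHolOn_apply (A := B) (B := A) (hL.mono Set.inter_subset_right)
    (h.mono Set.inter_subset_left)).congr fun y hy => (hLT y hy.2 _).symm

/-- Evaluation `E → E**`. -/
def eval (E : HolBundle.{u} X) (x : X) : E.Fiber x →L[ℂ] (E.Fiber x →L[ℂ] ℂ) →L[ℂ] ℂ :=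
  haveI : FiniteDimensional ℂ (E.Fiber x →L[ℂ] ℂ) := finiteDimensional_fiber E.dual x
  LinearMap.toContinuousBilin (LinearMap.mk₂ ℂ (fun v (ξ : E.Fiber x →L[ℂ] ℂ) => ξ v)
    (fun v w ξ => ξ.map_add v w) (fun c v ξ => ξ.map_smul c v) (fun _ _ _ => rfl)
    (fun _ _ _ => rfl))

lemma eq_of_forall_dual (E : HolBundle.{u} X) {x : X} {v w : E.Fiber x}
    (h : ∀ ξ : E.Fiber x →L[ℂ] ℂ, ξ v = ξ w) : v = w := by
  refine (Module.forall_dual_apply_eq_zero_iff ℂ (v - w)).1 (fun f => ?_) |> sub_eq_zero.1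
  rw [map_sub, sub_eq_zero]
  exact h (LinearMap.toContinuousLinearMap f)

lemma eval_injective (E : HolBundle.{u} X) (x : X) : Function.Injective (E.eval x) :=
  fun _ _ h => E.eq_of_forall_dual fun ξ => DFunLike.congr_fun h ξ

/-- A bilinear pairing with the dual space is given by a linear map into the space. -/
lemma exists_clm_of_dual_pairing (E : HolBundle.{u} X) {x : X} {F : Type*} [AddCommGroup F]
    [Module ℂ F] [TopologicalSpace F] [IsTopologicalAddGroup F] [ContinuousSMul ℂ F]
    [FiniteDimensional ℂ F] [T2Space F] (β : F →ₗ[ℂ] (E.Fiber x →L[ℂ] ℂ) →ₗ[ℂ] ℂ) :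
    ∃ s : F →L[ℂ] E.Fiber x, ∀ (y : F) (ξ : E.Fiber x →L[ℂ] ℂ), ξ (s y) = β y ξ := by
  -- In finite dimension algebraic and continuous duals coincide, so the pairing is a map into the
  -- double dual, and evaluation can be inverted.
  let γ : F →ₗ[ℂ] Module.Dual ℂ (Module.Dual ℂ (E.Fiber x)) :=
    β.compl₂ (LinearMap.toContinuousLinearMap (𝕜 := ℂ) (E := E.Fiber x) (F' := ℂ)).toLinearMap
  let s := (Module.evalEquiv ℂ (E.Fiber x)).symm.toLinearMap.comp γ
  refine ⟨LinearMap.toContinuousLinearMap s, fun y ξ => ?_⟩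
  have h := LinearMap.congr_fun ((Module.evalEquiv ℂ (E.Fiber x)).apply_symm_apply (γ y))
    (ξ : E.Fiber x →ₗ[ℂ] ℂ)
  exact h.trans (congrArg (β y) (by ext; rfl))

lemma isHolOn_eval (E : HolBundle.{u} X) (U : Set X) (hU : IsOpen U) :
    (E.hom E.dual.dual).IsHolOn E.eval U :=
  isHolOn_of_apply hU fun _ hV _ _ hv => isHolOn_of_apply hV fun _ _ hVV _ hξ =>
    isHolOn_apply (A := E) (B := trivialLine X) hξ (hv.mono hVV)

/-- A section is holomorphic if its pairings with local holomorphic sections of the dual are. -/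
lemma isHolOn_of_dual_apply {E : HolBundle.{u} X} {U : Set X} (hU : IsOpen U)
    {a : ∀ x, E.Fiber x}
    (h : ∀ V : Set X, IsOpen V → V ⊆ U → ∀ ξ : ∀ x, E.Fiber x →L[ℂ] ℂ, E.dual.IsHolOn ξ V →
      (trivialLine X).IsHolOn (fun x => ξ x (a x)) V) :
    E.IsHolOn a U :=
  -- Evaluation embeds `E` holomorphically in `E**`, where holomorphy means holomorphy of all
  -- pairings.
  isHolOn_of_injective_apply (A := E) (B := E.dual.dual) hU (E.isHolOn_eval U hU) E.eval_injective
    (isHolOn_of_apply hU h)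

end HolBundle

/-! ### Transposes, splittings and quotients of Higgs bundles -/

namespace HiggsBundle

variable {X : Type v} [TopologicalSpace X] [ChartedSpace ℂ X] [IsManifold 𝓘(ℂ) ω X]

/-- The identity isomorphism. -/
def Iso.refl (A : HiggsBundle.{u} X) : Iso A A :=
  let f : Hom A A :=
    { map := fun x => ContinuousLinearMap.id ℂ (A.E.Fiber x)
      hol := HolBundle.isHolOn_of_apply isOpen_univ fun _ _ _ _ ha => ha
      comm := fun _ _ _ => rfl }
  { toHom := f, inv := f, left_inv := fun _ _ => rfl, right_inv := fun _ _ => rfl }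

lemma Hom.isHolOn_map {A B : HiggsBundle.{u} X} (f : Hom A B) {U : Set X} {a : ∀ x, A.E.Fiber x}
    (ha : A.E.IsHolOn a U) : B.E.IsHolOn (fun x => f.map x (a x)) U :=
  HolBundle.isHolOn_apply (A := A.E) (B := B.E) (f.hol.mono (Set.subset_univ U)) ha

lemma isHolOn_Φ (A : HiggsBundle.{u} X) {U : Set X} {t : ∀ x : X, TangentSpace 𝓘(ℂ) x}
    {a : ∀ x, A.E.Fiber x}
    (ht : (HolBundle.tangent X).IsHolOn t U) (ha : A.E.IsHolOn a U) :
    A.E.IsHolOn (fun x => A.Φ x (t x) (a x)) U :=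
  HolBundle.isHolOn_apply (A := A.E) (B := A.E) (s := fun x => A.Φ x (t x))
    (HolBundle.isHolOn_apply (A.hol.mono (Set.subset_univ U)) ht) ha

/-- An endomorphism of the dual Higgs bundle is the transpose of an endomorphism. -/
lemma Hom.exists_transpose {W : HiggsBundle.{u} X} (g : Hom W.dual W.dual) :
    ∃ f : Hom W W, ∀ x (w : W.E.Fiber x) (ξ : W.E.Fiber x →L[ℂ] ℂ),
      ξ (f.map x w) = (g.map x ξ : W.E.Fiber x →L[ℂ] ℂ) w := by
  have hex : ∀ x, ∃ f : W.E.Fiber x →L[ℂ] W.E.Fiber x, ∀ (w : W.E.Fiber x)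
      (ξ : W.E.Fiber x →L[ℂ] ℂ), ξ (f w) = (g.map x ξ : W.E.Fiber x →L[ℂ] ℂ) w := by
    intro x
    have := HolBundle.finiteDimensional_fiber W.E.dual x
    exact W.E.exists_clm_of_dual_pairing (LinearMap.mk₂ ℂ
      (fun w (ξ : W.E.Fiber x →L[ℂ] ℂ) => (g.map x ξ : W.E.Fiber x →L[ℂ] ℂ) w)
      (fun w w' ξ => ContinuousLinearMap.map_add (g.map x ξ : W.E.Fiber x →L[ℂ] ℂ) w w')
      (fun c w ξ => ContinuousLinearMap.map_smul (g.map x ξ : W.E.Fiber x →L[ℂ] ℂ) c w)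
      (fun w ξ ξ' => DFunLike.congr_fun ((g.map x).map_add ξ ξ') w)
      (fun c w ξ => DFunLike.congr_fun ((g.map x).map_smul c ξ) w))
  choose f hf using hex
  refine ⟨⟨f, ?_, ?_⟩, hf⟩
  · refine HolBundle.isHolOn_of_apply isOpen_univ fun V hV _ w hw => ?_
    refine HolBundle.isHolOn_of_dual_apply hV fun V' hV' hVV' ξ hξ => ?_
    have h1 := g.isHolOn_map hξ
    refine (HolBundle.isHolOn_apply (A := W.E) (B := HolBundle.trivialLine X) h1
      (hw.mono hVV')).congr fun x hx => ?_
    exact hf x (w x) (ξ x)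
  · intro x t w
    refine W.E.eq_of_forall_dual fun ξ => ?_
    have h1 := DFunLike.congr_fun (g.comm x t ξ) w
    have h2 : W.dual.Φ x t ξ = -(ξ.comp (W.Φ x t)) :=
      ContinuousLinearMap.ext fun w => W.dual_apply x t ξ w
    rw [W.dual_apply, h2] at h1
    -- The signs of the two dual Higgs fields `-ᵗφ` cancel, so the transpose commutes with `φ`
    -- itself.
    have h3 := neg_injective
      ((DFunLike.congr_fun ((g.map x).map_neg (ξ.comp (W.Φ x t))) w).symm.trans h1)
    rw [hf]
    exact h3.symm.trans (hf x w (ξ.comp (W.Φ x t))).symm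

/-- Transposition reverses composition: the transposes of `g` and of its inverse are mutually
inverse, each identity coming from the opposite one for `g`. -/
lemma Iso.exists_transpose {W : HiggsBundle.{u} X} (g : Iso W.dual W.dual) :
    ∃ f : Iso W W, ∀ x (w : W.E.Fiber x) (ξ : W.E.Fiber x →L[ℂ] ℂ),
      ξ (f.toHom.map x w) = (g.toHom.map x ξ : W.E.Fiber x →L[ℂ] ℂ) w := by
  obtain ⟨f, hf⟩ := g.toHom.exists_transpose
  obtain ⟨f', hf'⟩ := g.inv.exists_transpose
  refine ⟨⟨f, f', fun x a => ?_, fun x a => ?_⟩, hf⟩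
  · refine W.E.eq_of_forall_dual fun ξ => ?_
    rw [hf', hf, g.right_inv]
  · refine W.E.eq_of_forall_dual fun ξ => ?_
    rw [hf, hf', g.left_inv]

namespace Extension

variable {A B : HiggsBundle.{u} X}

lemma p_i (𝓔 : Extension B A) (x : X) (a : A.E.Fiber x) : 𝓔.p.map x (𝓔.i.map x a) = 0 :=
  (𝓔.exact x _).2 ⟨a, rfl⟩

/-- A purely fibrewise choice, with no regularity in `x`. It serves to define the `W`-component of a
vector; holomorphy is recovered afterwards by applying `i`, through `isHolOn_of_i`. -/
lemma exists_retraction (𝓔 : Extension B A) :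
    ∃ ρ : ∀ x, 𝓔.V.E.Fiber x →L[ℂ] A.E.Fiber x, (∀ x a, ρ x (𝓔.i.map x a) = a) ∧
      ∀ x v, 𝓔.p.map x v = 0 → 𝓔.i.map x (ρ x v) = v := by
  choose ρ hρ using fun x => HolBundle.exists_clm_leftInverse (𝓔.i.map x) (𝓔.injective x)
  refine ⟨ρ, hρ, fun x v hv => ?_⟩
  obtain ⟨a, rfl⟩ := (𝓔.exact x v).1 hv
  rw [hρ]

lemma isHolOn_of_i (𝓔 : Extension B A) {U : Set X} (hU : IsOpen U) {a : ∀ x, A.E.Fiber x}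
    (h : 𝓔.V.E.IsHolOn (fun x => 𝓔.i.map x (a x)) U) : A.E.IsHolOn a U :=
  HolBundle.isHolOn_of_injective_apply (A := A.E) (B := 𝓔.V.E) hU
    (𝓔.i.hol.mono (Set.subset_univ U)) 𝓔.injective h

/-- A family of local holomorphic splittings of the projection of an extension. -/
structure Splitting (𝓔 : Extension B A) where
  cover : PointedCover X
  map : ∀ (_ x : X), B.E.Fiber x →L[ℂ] 𝓔.V.E.Fiber x
  hol : ∀ j, (B.E.hom 𝓔.V.E).IsHolOn (map j) (cover.set j)
  p_map : ∀ j, ∀ x ∈ cover.set j, ∀ b, 𝓔.p.map x (map j x b) = b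

/-- Local holomorphic splittings exist. -/
lemma nonempty_splitting (𝓔 : Extension B A) : Nonempty 𝓔.Splitting := by
  choose N h hN hxN _ hh hp using fun x => HolBundle.exists_isHolOn_rightInverse
    (A := 𝓔.V.E) (B := B.E) isOpen_univ (Set.mem_univ x) 𝓔.p.hol (𝓔.surjective x)
  exact ⟨⟨⟨fun x => ⟨N x, hN x⟩, hxN⟩, h, hh, hp⟩⟩

/-- A homomorphism killing the subobject factors through the quotient. -/
lemma exists_desc (𝓔 : Extension B A) {C : HiggsBundle.{u} X} (f : Hom 𝓔.V C)
    (hf : ∀ x a, f.map x (𝓔.i.map x a) = 0) :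
    ∃ g : Hom B C, ∀ x v, g.map x (𝓔.p.map x v) = f.map x v := by
  have hker : ∀ x v v', 𝓔.p.map x v = 𝓔.p.map x v' → f.map x v = f.map x v' := by
    intro x v v' h
    have h1 : 𝓔.p.map x (v - v') = 0 := by rw [map_sub, h, sub_self]
    obtain ⟨a, ha⟩ := (𝓔.exact x _).1 h1
    rw [← sub_eq_zero, ← map_sub, ← ha, hf]
  choose r hr using fun x => HolBundle.exists_clm_rightInverse (𝓔.p.map x) (𝓔.surjective x)
  have key : ∀ x v, (f.map x).comp (r x) (𝓔.p.map x v) = f.map x v := fun x v =>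
    hker x _ _ (hr x _)
  refine ⟨⟨fun x => (f.map x).comp (r x), ?_, ?_⟩, key⟩
  -- The right inverses `r x` need not vary holomorphically, but `f` depends only on the image under
  -- `p`, so `r` may be replaced locally by a holomorphic splitting.
  · obtain ⟨σ⟩ := 𝓔.nonempty_splitting
    refine HolBundle.isHolOn_of_local fun x _ =>
      ⟨σ.cover.set x, (σ.cover.set x).isOpen, σ.cover.mem x, ?_⟩
    refine HolBundle.IsHolOn.mono ?_ Set.inter_subset_right
    refine (HolBundle.isHolOn_comp (A := B.E) (B := 𝓔.V.E) (C := C.E) (σ.cover.set x).isOpen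
      (f.hol.mono (Set.subset_univ _)) (σ.hol x)).congr fun y hy => ?_
    exact ContinuousLinearMap.ext fun b => hker y _ _ ((hr y b).trans (σ.p_map x y hy b).symm)
  · intro x t b
    obtain ⟨v, rfl⟩ := 𝓔.surjective x b
    rw [← 𝓔.p.comm, key, key, f.comm]

/-- Two projections with the same kernel differ by an isomorphism. -/
lemma exists_iso_of_exact (𝓔 : Extension B A) (q : Hom 𝓔.V B)
    (hq : ∀ x, Function.Surjective (q.map x))
    (hex : ∀ x v, q.map x v = 0 ↔ ∃ a, 𝓔.i.map x a = v) :
    ∃ g : Iso B B, ∀ x v, g.toHom.map x (𝓔.p.map x v) = q.map x v := by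
  obtain ⟨g, hg⟩ := 𝓔.exists_desc q fun x a => (hex x _).2 ⟨a, rfl⟩
  -- With `q` as projection `V` is again an extension of the same bundles; descending `p` through it
  -- gives the inverse of `g`.
  let 𝓔' : Extension B A := ⟨𝓔.V, 𝓔.i, q, 𝓔.injective, hq, hex⟩
  obtain ⟨g', hg'⟩ := 𝓔'.exists_desc 𝓔.p 𝓔.p_i
  refine ⟨⟨g, g', fun x b => ?_, fun x b => ?_⟩, hg⟩
  · obtain ⟨v, rfl⟩ := 𝓔.surjective x b
    rw [hg]
    exact hg' x v
  · obtain ⟨v, rfl⟩ := hq x b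
    have h := hg' x v
    change g'.map x (q.map x v) = _ at h
    rw [h, hg]

lemma StronglyEquivalent.refl (𝓔 : Extension B A) : 𝓔.StronglyEquivalent 𝓔 :=
  ⟨Iso.refl 𝓔.V, fun _ _ => rfl, fun _ _ => rfl⟩

lemma StronglyEquivalent.weaklyEquivalent {𝓔 𝓔' : Extension B A} (h : 𝓔.StronglyEquivalent 𝓔') :
    𝓔.WeaklyEquivalent 𝓔' := by
  obtain ⟨F, hi, hp⟩ := h
  exact ⟨Iso.refl A, Iso.refl B, F, hi, hp⟩

end Extension

/-! ### Transport of forms and the projection defined by a form -/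

namespace FormStructure

variable {k : FormKind}

/-- The form transported along an isomorphism. -/
def pullback {V V' : HiggsBundle.{u} X} (α : FormStructure k V') (F : Iso V V') :
    FormStructure k V where
  form x := LinearMap.toContinuousBilin (LinearMap.mk₂ ℂ
    (fun v w => α.form x (F.toHom.map x v) (F.toHom.map x w))
    (fun v v' w => by simp) (fun c v w => by simp) (fun v w w' => by simp) (fun c v w => by simp))
  hol := HolBundle.isHolOn_of_apply isOpen_univ fun U hU _ v hv =>
    HolBundle.isHolOn_of_apply hU fun U' _ hUU' w hw =>
      HolBundle.isHolOn_apply (A := V'.E) (B := HolBundle.trivialLine X)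
        (HolBundle.isHolOn_apply (A := V'.E) (B := V'.E.dual) (α.hol.mono (Set.subset_univ U'))
          (F.toHom.isHolOn_map (hv.mono hUU'))) (F.toHom.isHolOn_map hw)
  symm x v w := α.symm x _ _
  nondegenerate x v h := by
    have h1 := α.nondegenerate x (F.toHom.map x v) fun w => by
      have h2 := h (F.inv.map x w)
      rwa [LinearMap.toContinuousBilin_apply, LinearMap.mk₂_apply, F.right_inv] at h2
    rw [← F.left_inv x v, h1, map_zero]
  skew x t v w := by
    simp only [LinearMap.toContinuousBilin_apply, LinearMap.mk₂_apply, F.toHom.comm]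
    exact α.skew x t _ _

lemma pullback_form {V V' : HiggsBundle.{u} X} (α : FormStructure k V') (F : Iso V V') (x : X)
    (v w : V.E.Fiber x) :
    (α.pullback F).form x v w = α.form x (F.toHom.map x v) (F.toHom.map x w) := rfl

/-- A nonzero multiple of a form. -/
def smul {V : HiggsBundle.{u} X} (c : ℂ) (hc : c ≠ 0) (α : FormStructure k V) :
    FormStructure k V where
  form x := c • α.form x
  hol := HolBundle.IsHolOn.const_smul (E := V.E.hom V.E.dual) c α.hol
  symm x v w := by
    have h := α.symm x v w
    simp only [smul_apply, smul_eq_mul, h]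
    ring
  nondegenerate x v h := α.nondegenerate x v fun w => by simpa [hc] using h w
  skew x t v w := by simp [α.skew x t v w]

lemma smul_form {V : HiggsBundle.{u} X} (c : ℂ) (hc : c ≠ 0) (α : FormStructure k V) (x : X)
    (v w : V.E.Fiber x) : (α.smul c hc).form x v w = c * α.form x v w := rfl

/-- Only the compatibility of `F` with the inclusions matters, and only up to an automorphism of
`W`: then `F` carries `i(W)` onto `i'(W)`. This is why weak equivalence is enough to transport
maximal isotropy. -/
lemma IsMaximallyIsotropic.pullback {W : HiggsBundle.{u} X} {𝓔 𝓔' : Extension W.dual W}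
    {α : FormStructure k 𝓔'.V} (hα : α.IsMaximallyIsotropic 𝓔'.i) {f : Iso W W}
    {F : Iso 𝓔.V 𝓔'.V}
    (hF : ∀ x a, F.toHom.map x (𝓔.i.map x a) = 𝓔'.i.map x (f.toHom.map x a)) :
    (α.pullback F).IsMaximallyIsotropic 𝓔.i := by
  intro x v
  simp only [pullback_form, hF]
  constructor
  · intro h
    obtain ⟨a, ha⟩ := (hα x (F.toHom.map x v)).1 fun a => by
      have := h (f.inv.map x a)
      rwa [f.right_inv] at this
    refine ⟨f.inv.map x a, ?_⟩
    rw [← F.left_inv x (𝓔.i.map x _), hF, f.right_inv, ha, F.left_inv]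
  · rintro ⟨a, rfl⟩ b
    exact (hα x _).2 ⟨f.toHom.map x a, (hF x a).symm⟩ _

lemma IsMaximallyIsotropic.smul {A V : HiggsBundle.{u} X} {i : Hom A V} {α : FormStructure k V}
    (hα : α.IsMaximallyIsotropic i) (c : ℂ) (hc : c ≠ 0) :
    (α.smul c hc).IsMaximallyIsotropic i := by
  intro x v
  simp [smul_form, hc, hα x v]

lemma InducesProjection.pullback {W : HiggsBundle.{u} X} {𝓔 𝓔' : Extension W.dual W}
    {α : FormStructure k 𝓔'.V} (hα : α.InducesProjection 𝓔') {F : Iso 𝓔.V 𝓔'.V}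
    (hi : ∀ x a, F.toHom.map x (𝓔.i.map x a) = 𝓔'.i.map x a)
    (hp : ∀ x v, 𝓔'.p.map x (F.toHom.map x v) = 𝓔.p.map x v) :
    (α.pullback F).InducesProjection 𝓔 := by
  intro x v w
  rw [pullback_form, hi, ← hp, hα]

/-- The projection `V → W*`, `v ↦ α(v, ·)|_W`, defined by a form on `V`. -/
def projection {W V : HiggsBundle.{u} X} (α : FormStructure k V) (i : Hom W V) :
    Hom V W.dual where
  map x := LinearMap.toContinuousBilin (LinearMap.mk₂ ℂ
    (fun v w => (α.form x v (i.map x w) : ℂ))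
    (fun v v' w => by simp) (fun c v w => by simp) (fun v w w' => by simp) (fun c v w => by simp))
  hol := HolBundle.isHolOn_of_apply isOpen_univ fun U hU _ v hv =>
    HolBundle.isHolOn_of_apply hU fun U' _ hUU' w hw =>
      HolBundle.isHolOn_apply (A := V.E) (B := HolBundle.trivialLine X)
        (HolBundle.isHolOn_apply (A := V.E) (B := V.E.dual) (α.hol.mono (Set.subset_univ U'))
          (hv.mono hUU')) (i.isHolOn_map hw)
  comm x t v := by
    refine ContinuousLinearMap.ext fun w => ?_
    refine Eq.trans ?_ (W.dual_apply x t _ w).symm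
    -- Skewness of `Φ` with one argument in `i(W)` is exactly compatibility with `-ᵗφ` on the dual.
    have h := α.skew x t v (i.map x w)
    rw [← i.comm] at h
    exact h

lemma projection_apply {W V : HiggsBundle.{u} X} (α : FormStructure k V) (i : Hom W V) (x : X)
    (v : V.E.Fiber x) (w : W.E.Fiber x) :
    ((α.projection i).map x v : W.E.Fiber x →L[ℂ] ℂ) w = α.form x v (i.map x w) := rfl

/-- Non-degeneracy makes `V → V*` injective, and the dimensions are equal. -/
lemma form_surjective {V : HiggsBundle.{u} X} (α : FormStructure k V) (x : X)
    (η : V.E.Fiber x →L[ℂ] ℂ) : ∃ v, ∀ w, α.form x v w = η w := by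
  let T : V.E.Fiber x →ₗ[ℂ] Module.Dual ℂ (V.E.Fiber x) :=
    LinearMap.mk₂ ℂ (fun v w => (α.form x v w : ℂ))
      (fun v v' w => by simp) (fun c v w => by simp) (fun v w w' => by simp)
      (fun c v w => by simp)
  have hT : Function.Injective T := by
    refine (injective_iff_map_eq_zero T).2 fun v hv => α.nondegenerate x v fun w => ?_
    exact LinearMap.congr_fun hv w
  obtain ⟨v, hv⟩ := (LinearMap.injective_iff_surjective_of_finrank_eq_finrank
    (Subspace.dual_finrank_eq (K := ℂ) (V := V.E.Fiber x)).symm).1 hT (η : V.E.Fiber x →ₗ[ℂ] ℂ)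
  exact ⟨v, fun w => LinearMap.congr_fun hv w⟩

/-- A functional on `W` extends to `V` through a left inverse of `i`, and the extension is
represented by a vector since the form is non-degenerate. -/
lemma projection_surjective {W V : HiggsBundle.{u} X} (α : FormStructure k V) (i : Hom W V) (x : X)
    (hi : Function.Injective (i.map x)) : Function.Surjective ((α.projection i).map x) := by
  intro ξ
  obtain ⟨L, hL⟩ := HolBundle.exists_clm_leftInverse (i.map x) hi
  obtain ⟨v, hv⟩ := α.form_surjective x (ContinuousLinearMap.comp (ξ : W.E.Fiber x →L[ℂ] ℂ) L)
  refine ⟨v, ContinuousLinearMap.ext fun w => (hv _).trans ?_⟩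
  exact congrArg (ξ : W.E.Fiber x →L[ℂ] ℂ) (hL w)

lemma IsMaximallyIsotropic.projection_eq_zero_iff {W V : HiggsBundle.{u} X}
    {α : FormStructure k V} {i : Hom W V} (hα : α.IsMaximallyIsotropic i) (x : X)
    (v : V.E.Fiber x) : (α.projection i).map x v = 0 ↔ ∃ a, i.map x a = v := by
  rw [← hα x v]
  exact ⟨fun h a => DFunLike.congr_fun h a, fun h => ContinuousLinearMap.ext h⟩

/-- The extension with the projection induced by a form. -/
def extension {W : HiggsBundle.{u} X} {𝓔 : Extension W.dual W} (α : FormStructure k 𝓔.V)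
    (hα : α.IsMaximallyIsotropic 𝓔.i) : Extension W.dual W where
  V := 𝓔.V
  i := 𝓔.i
  p := α.projection 𝓔.i
  injective := 𝓔.injective
  surjective x := α.projection_surjective 𝓔.i x (𝓔.injective x)
  exact := hα.projection_eq_zero_iff

end FormStructure

end HiggsBundle

/-! ### Hypercohomology classes and cocycles of splittings -/

namespace HiggsBundle

variable {X : Type v} [TopologicalSpace X] [ChartedSpace ℂ X] [IsManifold 𝓘(ℂ) ω X]

namespace InvariantSub

variable {E : HiggsBundle.{u} X}

lemma inclH₁_classOf (L : E.InvariantSub) (U : PointedCover X) (z : L.Z₁ U) :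
    L.inclH₁ (L.classOf U z) = (whole E).classOf U (L.inclZ₁ U z) :=
  Module.DirectLimit.map_apply_of _ _ _

lemma exists_classOf (L : E.InvariantSub) (c : L.hyperH₁) :
    ∃ (U : PointedCover X) (z : L.Z₁ U), L.classOf U z = c := by
  obtain ⟨U, y, rfl⟩ := Module.DirectLimit.exists_of c
  obtain ⟨z, rfl⟩ := L.mkH₁_surjective U y
  exact ⟨U, z, rfl⟩

lemma classOf_resZ₁ (L : E.InvariantSub) {U V : PointedCover X} (h : U ≤ V) (z : L.Z₁ U) :
    L.classOf V (L.resZ₁ h z) = L.classOf U z :=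
  Module.DirectLimit.of_f (R := ℂ) (G := L.cechH₁) (f := L.resH₁) (hij := h) (x := L.mkH₁ U z)

/-- Two elements of a direct limit that agree already agree at a finite stage, here on a common
refinement, where equality of classes means differing by a coboundary. -/
lemma exists_coboundary_of_classOf_eq (L : E.InvariantSub) {U U' : PointedCover X} {z : L.Z₁ U}
    {z' : L.Z₁ U'} (h : L.classOf U z = L.classOf U' z') :
    ∃ (V : PointedCover X) (hU : U ≤ V) (hU' : U' ≤ V) (θ : L.C₀ V),
      L.resC₁ hU z.1 - L.resC₁ hU' z'.1 = L.d₀ V θ := by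
  obtain ⟨V₀, h₀, h₀'⟩ := exists_ge_ge U U'
  rw [← L.classOf_resZ₁ h₀ z, ← L.classOf_resZ₁ h₀' z'] at h
  obtain ⟨V, hV, h1⟩ := Module.DirectLimit.exists_eq_of_of_eq h
  rw [resH₁_mkH₁, resH₁_mkH₁] at h1
  obtain ⟨θ, hθ⟩ := (Submodule.Quotient.eq _).1 h1
  exact ⟨V, h₀.trans hV, h₀'.trans hV, θ, hθ.symm⟩

lemma mem_Z₁_of_forall (L : E.InvariantSub) {U : PointedCover X} {z : L.C₁ U}
    (h₁ : ∀ i j k (x : (U.set i ⊓ U.set j ⊓ U.set k : Opens X)),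
      (z.1 j k).1 ⟨x, x.2.1.2, x.2.2⟩ - (z.1 i k).1 ⟨x, x.2.1.1, x.2.2⟩ +
        (z.1 i j).1 ⟨x, x.2.1⟩ = 0)
    (h₂ : ∀ i j (x : (U.set i ⊓ U.set j : Opens X)) (t : TangentSpace 𝓘(ℂ) (x : X)),
      E.Φ x t ((z.1 i j).1 x) - ((z.2 j).1 ⟨x, x.2.2⟩ t - (z.2 i).1 ⟨x, x.2.1⟩ t) = 0) :
    z ∈ L.Z₁ U := by
  refine LinearMap.mem_ker.2 (Prod.ext ?_ ?_)
  · funext i j k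
    exact Subtype.ext <| funext fun x => h₁ i j k x
  · funext i j
    exact Subtype.ext <| funext fun x => ContinuousLinearMap.ext fun t => h₂ i j x t

end InvariantSub

namespace Extension

variable {A B : HiggsBundle.{u} X} {𝓔 : Extension B A}

/-- The cocycle of a family of local splittings takes values in `L`. -/
structure Splitting.TakesValuesIn (σ : 𝓔.Splitting) (L : (B.hom A).InvariantSub) : Prop where
  map_sub : ∀ j k, ∀ x ∈ σ.cover.set j, x ∈ σ.cover.set k →
    ∃ s : B.E.Fiber x →L[ℂ] A.E.Fiber x, s ∈ L.fiber x ∧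
      ∀ b, 𝓔.i.map x (s b) = σ.map k x b - σ.map j x b
  higgs : ∀ j, ∀ x ∈ σ.cover.set j, ∀ t : TangentSpace 𝓘(ℂ) x,
    ∃ s : B.E.Fiber x →L[ℂ] A.E.Fiber x, s ∈ L.fiber x ∧
      ∀ b, 𝓔.i.map x (s b) = 𝓔.V.Φ x t (σ.map j x b) - σ.map j x (B.Φ x t b)

/-- Injectivity of `i` makes the values unique, so those computed with a retraction are the values
in `L` provided by the hypothesis. They are holomorphic because their images under `i` are. -/
lemma Splitting.exists_cochain (σ : 𝓔.Splitting) {L : (B.hom A).InvariantSub}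
    (hσ : σ.TakesValuesIn L) :
    ∃ (b : ∀ _ _ x : X, B.E.Fiber x →L[ℂ] A.E.Fiber x)
      (ψ : ∀ _ x : X, TangentSpace 𝓘(ℂ) x →L[ℂ] B.E.Fiber x →L[ℂ] A.E.Fiber x),
      (∀ j k, ∀ x ∈ σ.cover.set j, x ∈ σ.cover.set k → b j k x ∈ L.fiber x ∧
        ∀ y, 𝓔.i.map x (b j k x y) = σ.map k x y - σ.map j x y) ∧
      (∀ j, ∀ x ∈ σ.cover.set j, ∀ t, ψ j x t ∈ L.fiber x ∧
        ∀ y, 𝓔.i.map x (ψ j x t y) = 𝓔.V.Φ x t (σ.map j x y) - σ.map j x (B.Φ x t y)) ∧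
      (∀ j k, (B.E.hom A.E).IsHolOn (b j k) (σ.cover.set j ⊓ σ.cover.set k : Opens X)) ∧
      ∀ j, (B.E.hom A.E).twist.IsHolOn (ψ j) (σ.cover.set j) := by
  obtain ⟨ρ, hρ, -⟩ := 𝓔.exists_retraction
  let b : ∀ _ _ x : X, B.E.Fiber x →L[ℂ] A.E.Fiber x := fun j k x =>
    (ρ x).comp (σ.map k x - σ.map j x)
  let ψ : ∀ _ x : X, TangentSpace 𝓘(ℂ) x →L[ℂ] B.E.Fiber x →L[ℂ] A.E.Fiber x := fun j x =>
    haveI : FiniteDimensional ℂ (TangentSpace 𝓘(ℂ) x) :=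
      HolBundle.finiteDimensional_fiber (HolBundle.tangent X) x
    haveI : T2Space (TangentSpace 𝓘(ℂ) x) := HolBundle.t2_fiber (HolBundle.tangent X) x
    LinearMap.toContinuousBilin (LinearMap.mk₂ ℂ
      (fun t b => ρ x (𝓔.V.Φ x t (σ.map j x b) - σ.map j x (B.Φ x t b)))
      (fun t t' b => by rw [← map_add]; congr 1; simp; abel)
      (fun c t b => by rw [← map_smul]; congr 1; simp [smul_sub])
      (fun t b b' => by rw [← map_add]; congr 1; simp; abel)
      (fun c t b => by rw [← map_smul]; congr 1; simp [smul_sub]))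
  have hb : ∀ j k, ∀ x ∈ σ.cover.set j, x ∈ σ.cover.set k → b j k x ∈ L.fiber x ∧
      ∀ y, 𝓔.i.map x (b j k x y) = σ.map k x y - σ.map j x y := by
    intro j k x hj hk
    obtain ⟨s, hs, h⟩ := hσ.map_sub j k x hj hk
    have : b j k x = s := ContinuousLinearMap.ext fun y => by
      rw [← hρ x (s y), h]
      rfl
    rw [this]
    exact ⟨hs, h⟩
  have hψ : ∀ j, ∀ x ∈ σ.cover.set j, ∀ t, ψ j x t ∈ L.fiber x ∧
      ∀ y, 𝓔.i.map x (ψ j x t y) = 𝓔.V.Φ x t (σ.map j x y) - σ.map j x (B.Φ x t y) := by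
    intro j x hj t
    obtain ⟨s, hs, h⟩ := hσ.higgs j x hj t
    have : ψ j x t = s := ContinuousLinearMap.ext fun y => by
      rw [← hρ x (s y), h]
      rfl
    rw [this]
    exact ⟨hs, h⟩
  let U := σ.cover
  have hσj : ∀ j {V : Set X} {y : ∀ x, B.E.Fiber x}, V ⊆ U.set j → B.E.IsHolOn y V →
      𝓔.V.E.IsHolOn (fun x => σ.map j x (y x)) V := fun j V y hV hy =>
    HolBundle.isHolOn_apply (A := B.E) (B := 𝓔.V.E) ((σ.hol j).mono hV) hy
  have hbhol : ∀ j k, (B.E.hom A.E).IsHolOn (b j k) (U.set j ⊓ U.set k : Opens X) := by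
    intro j k
    refine HolBundle.isHolOn_of_apply (U.set j ⊓ U.set k).isOpen fun V hV hVU y hy => ?_
    refine 𝓔.isHolOn_of_i hV ?_
    exact ((hσj k (fun x hx => (hVU hx).2) hy).sub (hσj j (fun x hx => (hVU hx).1) hy)).congr
      fun x hx => (hb j k x (hVU hx).1 (hVU hx).2).2 _
  have hψhol : ∀ j, (B.E.hom A.E).twist.IsHolOn (ψ j) (U.set j) := by
    intro j
    refine HolBundle.isHolOn_of_apply (U.set j).isOpen fun V hV hVU t ht => ?_
    refine HolBundle.isHolOn_of_apply hV fun V' hV' hVV' y hy => ?_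
    refine 𝓔.isHolOn_of_i hV' ?_
    have hVU' := hVV'.trans hVU
    exact ((𝓔.V.isHolOn_Φ (ht.mono hVV') (hσj j hVU' hy)).sub
      (hσj j hVU' (B.isHolOn_Φ (ht.mono hVV') hy))).congr
      fun x hx => (hψ j x (hVU' hx) _).2 _
  exact ⟨b, ψ, hb, hψ, hbhol, hψhol⟩

/-- The cocycle equations may be checked after applying the injection `i`, where the first
telescopes and the second follows from `i` commuting with the Higgs fields. -/
lemma Splitting.exists_isClass (σ : 𝓔.Splitting) {L : (B.hom A).InvariantSub}
    (hσ : σ.TakesValuesIn L) : ∃ c : L.hyperH₁, 𝓔.IsClass (L.inclH₁ c) := by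
  obtain ⟨b, ψ, hb, hψ, hbhol, hψhol⟩ := σ.exists_cochain hσ
  let U := σ.cover
  let z : L.C₁ U :=
    (fun j k => ⟨fun x => b j k x, ⟨b j k, hbhol j k, fun _ => rfl⟩,
        fun x => (hb j k x x.2.1 x.2.2).1⟩,
      fun j => ⟨fun x => ψ j x, ⟨ψ j, hψhol j, fun _ => rfl⟩, fun x t => (hψ j x x.2 t).1⟩)
  have hz : z ∈ L.Z₁ U := by
    refine L.mem_Z₁_of_forall (fun i j k x => ?_) (fun i j x t => ?_)
    · refine ContinuousLinearMap.ext fun y => 𝓔.injective x ?_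
      have h1 := (hb j k x x.2.1.2 x.2.2).2 y
      have h2 := (hb i k x x.2.1.1 x.2.2).2 y
      have h3 := (hb i j x x.2.1.1 x.2.1.2).2 y
      change 𝓔.i.map x (b j k x y - b i k x y + b i j x y) = 𝓔.i.map x 0
      rw [map_add, map_sub, h1, h2, h3, map_zero]
      abel
    · refine ContinuousLinearMap.ext fun y => 𝓔.injective x ?_
      have h1 := (hb i j x x.2.1 x.2.2).2
      have h2 := (hψ i x x.2.1 t).2 y
      have h3 := (hψ j x x.2.2 t).2 y
      change 𝓔.i.map x (A.Φ x t (b i j x y) - b i j x (B.Φ x t y) - (ψ j x t y - ψ i x t y)) =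
        𝓔.i.map x 0
      rw [map_sub, map_sub, map_sub, 𝓔.i.comm, h1, h1, h2, h3, map_zero, map_sub]
      abel
  refine ⟨L.classOf U ⟨z, hz⟩, U, fun j => ⟨fun x => σ.map j x, σ.map j, σ.hol j, fun _ => rfl⟩,
    L.inclZ₁ U ⟨z, hz⟩, fun j x y => σ.p_map j x x.2 y, fun j k x y => ?_, fun j x t y => ?_,
    L.inclH₁_classOf U ⟨z, hz⟩⟩
  · exact (hb j k x x.2.1 x.2.2).2 y
  · exact (hψ j x x.2 t).2 y

/-- The cocycle of the given splittings minus an `L`-valued one is, on a refinement, the coboundary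
of some `θ`. Passing from `h_j` to `h_j - i θ_j` subtracts this coboundary. Injectivity of `ℍ¹(L) →
ℍ¹(B* ⊗ A)` plays no role. -/
lemma exists_splitting_of_isClass {L : (B.hom A).InvariantSub} {c : L.hyperH₁}
    (hc : 𝓔.IsClass (L.inclH₁ c)) : ∃ σ : 𝓔.Splitting, σ.TakesValuesIn L := by
  obtain ⟨U, h, z, hp, hb, hψ, hz⟩ := hc
  obtain ⟨U', z', rfl⟩ := L.exists_classOf c
  rw [L.inclH₁_classOf] at hz
  obtain ⟨V, hUV, hUV', θ, hθ⟩ := InvariantSub.exists_coboundary_of_classOf_eq _ hz.symm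
  choose H hH hHe using fun j => (h j).2
  choose Θ hΘ hΘe using fun j => (θ j).2.1
  let m : ∀ _ x : X, B.E.Fiber x →L[ℂ] 𝓔.V.E.Fiber x := fun j x =>
    H j x - (𝓔.i.map x).comp (Θ j x)
  have hm : ∀ j x y, m j x y = H j x y - 𝓔.i.map x (Θ j x y) := fun _ _ _ => rfl
  refine ⟨⟨V, m, fun j => ?_, fun j x hx y => ?_⟩, fun j k x hj hk => ?_, fun j x hj t => ?_⟩
  · exact HolBundle.IsHolOn.sub (E := B.E.hom 𝓔.V.E) ((hH j).mono (hUV j))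
      (HolBundle.isHolOn_comp (A := B.E) (B := A.E) (C := 𝓔.V.E) (V.set j).isOpen
        (𝓔.i.hol.mono (Set.subset_univ _)) (hΘ j))
  · rw [hm, map_sub, 𝓔.p_i, sub_zero]
    have := hp j ⟨x, hUV j hx⟩ y
    rwa [hHe] at this
  · refine ⟨(z'.1.1 j k).1 ⟨x, hUV' j hj, hUV' k hk⟩, (z'.1.1 j k).2.2 ⟨x, hUV' j hj, hUV' k hk⟩, fun y => ?_⟩
    have h1 := hb j k ⟨x, hUV j hj, hUV k hk⟩ y
    rw [hHe, hHe] at h1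
    have h2 : (z.1.1 j k).1 ⟨x, hUV j hj, hUV k hk⟩ y -
        (z'.1.1 j k).1 ⟨x, hUV' j hj, hUV' k hk⟩ y = (θ k).1 ⟨x, hk⟩ y - (θ j).1 ⟨x, hj⟩ y :=
      DFunLike.congr_fun (congrFun (congrArg Subtype.val
        (congrFun (congrFun (congrArg Prod.fst hθ) j) k)) ⟨x, hj, hk⟩) y
    rw [hΘe, hΘe, sub_eq_iff_eq_add, ← sub_eq_iff_eq_add'] at h2
    change 𝓔.i.map x _ = m k x y - m j x y
    rw [← h2, hm, hm, map_sub, map_sub]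
    refine (congrArg (· - _) h1).trans ?_
    dsimp only
    abel
  · refine ⟨(z'.1.2 j).1 ⟨x, hUV' j hj⟩ t, (z'.1.2 j).2.2 ⟨x, hUV' j hj⟩ t, fun y => ?_⟩
    have h1 := hψ j ⟨x, hUV j hj⟩ t y
    rw [hHe] at h1
    have h2 : (z.1.2 j).1 ⟨x, hUV j hj⟩ t y - (z'.1.2 j).1 ⟨x, hUV' j hj⟩ t y =
        A.Φ x t ((θ j).1 ⟨x, hj⟩ y) - (θ j).1 ⟨x, hj⟩ (B.Φ x t y) :=
      DFunLike.congr_fun (DFunLike.congr_fun (congrFun (congrArg Subtype.val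
        (congrFun (congrArg Prod.snd hθ) j)) ⟨x, hj⟩) t) y
    rw [hΘe, sub_eq_iff_eq_add, ← sub_eq_iff_eq_add'] at h2
    change 𝓔.i.map x _ = 𝓔.V.Φ x t (m j x y) - m j x (B.Φ x t y)
    rw [← h2, hm, hm, map_sub, map_sub, 𝓔.i.comm, map_sub]
    refine (congrArg (· - _) h1).trans ?_
    dsimp only
    abel

lemma exists_isClass_iff {L : (B.hom A).InvariantSub} :
    (∃ c : L.hyperH₁, 𝓔.IsClass (L.inclH₁ c)) ↔ ∃ σ : 𝓔.Splitting, σ.TakesValuesIn L :=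
  ⟨fun ⟨_, hc⟩ => exists_splitting_of_isClass hc, fun ⟨σ, hσ⟩ => σ.exists_isClass hσ⟩

end Extension

end HiggsBundle

/-! ### Forms and isotropic splittings -/

namespace HiggsBundle

variable {X : Type v} [TopologicalSpace X] [ChartedSpace ℂ X] [IsManifold 𝓘(ℂ) ω X]

lemma FormKind.sign_mul_self (k : FormKind) : k.sign * k.sign = 1 := by
  cases k <;> simp [FormKind.sign]

/-- The tensor sign is opposite to the sign of the form; stated this way, one computation covers
both the orthogonal and the symplectic case. -/
lemma FormKind.mem_square_iff (k : FormKind) (W : HiggsBundle.{u} X) {x : X}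
    {s : (W.E.Fiber x →L[ℂ] ℂ) →L[ℂ] W.E.Fiber x} :
    s ∈ (k.square W).fiber x ↔ ∀ ξ η : W.E.Fiber x →L[ℂ] ℂ, ξ (s η) = -k.sign * η (s ξ) := by
  cases k
  · exact Iff.rfl
  · have h : -FormKind.symplectic.sign = 1 := by simp [FormKind.sign]
    rw [h]
    exact Iff.rfl

variable {k : FormKind} {W : HiggsBundle.{u} X} {𝓔 : Extension W.dual W}

namespace FormStructure

lemma isHolOn_form {V : HiggsBundle.{u} X} (α : FormStructure k V) {U : Set X}
    {v w : ∀ x, V.E.Fiber x} (hv : V.E.IsHolOn v U) (hw : V.E.IsHolOn w U) :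
    (HolBundle.trivialLine X).IsHolOn (fun x => α.form x (v x) (w x)) U :=
  HolBundle.isHolOn_apply (A := V.E) (B := HolBundle.trivialLine X)
    (HolBundle.isHolOn_apply (A := V.E) (B := V.E.dual) (α.hol.mono (Set.subset_univ U)) hv) hw

/-- The projection induced by a form has local splittings with isotropic image. -/
lemma InducesProjection.exists_isotropic_splitting {α : FormStructure k 𝓔.V}
    (hα : α.InducesProjection 𝓔) (hiso : ∀ x a b, α.form x (𝓔.i.map x a) (𝓔.i.map x b) = 0) :
    ∃ σ : 𝓔.Splitting, ∀ j, ∀ x ∈ σ.cover.set j, ∀ ξ η,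
      α.form x (σ.map j x ξ) (σ.map j x η) = 0 := by
  obtain ⟨σ⟩ := 𝓔.nonempty_splitting
  -- The factor `-1/2`: replacing `h` by `h + i s` adds `ξ(s η) + ε η(s ξ)` to `α(h ξ, h η)`, and by
  -- the symmetry of `α` each of the two terms cancels half of it.
  have hex : ∀ j x, ∃ s : W.dual.E.Fiber x →L[ℂ] W.E.Fiber x,
      ∀ (η : W.dual.E.Fiber x) (ξ : W.E.Fiber x →L[ℂ] ℂ),
        ξ (s η) = (-1 / 2 : ℂ) * α.form x (σ.map j x ξ) (σ.map j x η) := by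
    intro j x
    exact W.E.exists_clm_of_dual_pairing (LinearMap.mk₂ ℂ
      (fun (η : W.dual.E.Fiber x) (ξ : W.E.Fiber x →L[ℂ] ℂ) =>
        (-1 / 2 : ℂ) * α.form x (σ.map j x ξ) (σ.map j x η))
      (fun η η' ξ => by rw [map_add, map_add, mul_add])
      (fun c η ξ => by rw [map_smul, map_smul, smul_eq_mul, smul_eq_mul]; ring)
      (fun η ξ ξ' => by
        rw [(σ.map j x).map_add ξ ξ', map_add, add_apply, mul_add])
      (fun c η ξ => by
        rw [(σ.map j x).map_smul c ξ, map_smul, smul_apply, smul_eq_mul,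
          smul_eq_mul]
        ring))
  choose s hs using hex
  have hhol : ∀ j, (W.dual.E.hom W.E).IsHolOn (s j) (σ.cover.set j) := by
    intro j
    refine HolBundle.isHolOn_of_apply (σ.cover.set j).isOpen fun V hV hVU η hη => ?_
    refine HolBundle.isHolOn_of_dual_apply hV fun V' hV' hVV' ξ hξ => ?_
    have h := HolBundle.IsHolOn.const_smul (-1 / 2 : ℂ) (α.isHolOn_form
      (HolBundle.isHolOn_apply (A := W.dual.E) (B := 𝓔.V.E)
        ((σ.hol j).mono (hVV'.trans hVU)) hξ)
      (HolBundle.isHolOn_apply (A := W.dual.E) (B := 𝓔.V.E)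
        ((σ.hol j).mono (hVV'.trans hVU)) (hη.mono hVV')))
    exact h.congr fun x _ => hs j x (η x) (ξ x)
  let m : ∀ _ x : X, W.dual.E.Fiber x →L[ℂ] 𝓔.V.E.Fiber x := fun j x =>
    σ.map j x + (𝓔.i.map x).comp (s j x)
  have hm : ∀ j x ξ, m j x ξ = σ.map j x ξ + 𝓔.i.map x (s j x ξ) := fun _ _ _ => rfl
  refine ⟨⟨σ.cover, m, fun j => ?_, fun j x hx ξ => ?_⟩, fun j x hx ξ η => ?_⟩
  · exact HolBundle.IsHolOn.add (E := W.dual.E.hom 𝓔.V.E) (σ.hol j)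
      (HolBundle.isHolOn_comp (A := W.dual.E) (B := W.E) (C := 𝓔.V.E) (σ.cover.set j).isOpen
        (𝓔.i.hol.mono (Set.subset_univ _)) (hhol j))
  · rw [hm, map_add, 𝓔.p_i, add_zero, σ.p_map j x hx]
  · have h1 : ∀ ζ w, α.form x (σ.map j x ζ) (𝓔.i.map x w) = (ζ : W.E.Fiber x →L[ℂ] ℂ) w := by
      intro ζ w
      rw [← hα, σ.p_map j x hx]
    have h2 := k.sign_mul_self
    have h3 := α.symm x (σ.map j x ξ) (σ.map j x η)
    change α.form x (m j x ξ) (m j x η) = 0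
    rw [hm, hm, map_add, map_add, add_apply, add_apply,
      hiso, h1, α.symm x (𝓔.i.map x _), h1, hs, hs]
    linear_combination (1 / 2) * h3

/-- The splittings of an orthogonal (symplectic) extension with isotropic image have a
skew-symmetric (symmetric) cocycle. -/
lemma InducesProjection.takesValuesIn {α : FormStructure k 𝓔.V}
    (hα : α.InducesProjection 𝓔) (hiso : ∀ x a b, α.form x (𝓔.i.map x a) (𝓔.i.map x b) = 0)
    (σ : 𝓔.Splitting)
    (hσ : ∀ j, ∀ x ∈ σ.cover.set j, ∀ ξ η, α.form x (σ.map j x ξ) (σ.map j x η) = 0) :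
    σ.TakesValuesIn (k.square W) := by
  obtain ⟨ρ, -, hρ⟩ := 𝓔.exists_retraction
  have h1 : ∀ j x, x ∈ σ.cover.set j → ∀ ζ w,
      α.form x (σ.map j x ζ) (𝓔.i.map x w) = (ζ : W.E.Fiber x →L[ℂ] ℂ) w := by
    intro j x hx ζ w
    rw [← hα, σ.p_map j x hx]
  refine ⟨fun j l x hj hl => ?_, fun j x hj t => ?_⟩
  · let s := (ρ x).comp (σ.map l x - σ.map j x)
    have hs : ∀ ξ, 𝓔.i.map x (s ξ) = σ.map l x ξ - σ.map j x ξ := fun ξ =>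
      hρ x _ (by
      change 𝓔.p.map x (σ.map l x ξ - σ.map j x ξ) = 0
      rw [map_sub, σ.p_map l x hl, σ.p_map j x hj, sub_self])
    refine ⟨s, k.mem_square_iff W |>.2 fun ξ η => ?_, hs⟩
    -- Substituting `h_l = h_j + i s` in the isotropy of `h_l`, only the cross terms `ξ(s η) + ε η(s
    -- ξ)` survive.
    have h3 := hσ l x hl ξ η
    rw [← sub_add_cancel (σ.map l x ξ) (σ.map j x ξ), ← sub_add_cancel (σ.map l x η) (σ.map j x η),
      ← hs, ← hs, map_add, map_add, add_apply, add_apply,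
      hiso, h1 j x hj, α.symm x (𝓔.i.map x _), h1 j x hj, hσ j x hj] at h3
    linear_combination h3
  · let s : W.dual.E.Fiber x →L[ℂ] W.E.Fiber x :=
      (ρ x).comp ((𝓔.V.Φ x t).comp (σ.map j x) - (σ.map j x).comp (W.dual.Φ x t))
    have hs : ∀ ξ, 𝓔.i.map x (s ξ) = 𝓔.V.Φ x t (σ.map j x ξ) - σ.map j x (W.dual.Φ x t ξ) :=
      fun ξ => hρ x _ (by
        change 𝓔.p.map x (𝓔.V.Φ x t (σ.map j x ξ) - σ.map j x (W.dual.Φ x t ξ)) = 0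
        rw [map_sub, 𝓔.p.comm, σ.p_map j x hj, σ.p_map j x hj, sub_self])
    refine ⟨s, k.mem_square_iff W |>.2 fun ξ η => ?_, hs⟩
    -- Isotropy of `h_j` kills the term `h_j(φ₂ η)`, so the tensor becomes `α(h_j ξ, Φ h_j η)`,
    -- whose symmetry type comes from `Φ` being skew.
    have h2 : ∀ ξ η : W.dual.E.Fiber x,
        (ξ : W.E.Fiber x →L[ℂ] ℂ) (s η) = α.form x (σ.map j x ξ) (𝓔.V.Φ x t (σ.map j x η)) := by
      intro ξ η
      rw [← h1 j x hj, hs, map_sub, hσ j x hj, sub_zero]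
    rw [h2, h2, α.symm x (σ.map j x ξ), α.skew]
    ring

end FormStructure

namespace Extension.Splitting

/-- The bilinear form on a fibre of `V` for which `i(W)` and the image of the `j`-th splitting are
isotropic, and which pairs them through the duality of `W` and `W*`. -/
def glue (k : FormKind) (ρ : ∀ x, 𝓔.V.E.Fiber x →L[ℂ] W.E.Fiber x)
    (σ : 𝓔.Splitting) (j x : X) : 𝓔.V.E.Fiber x →L[ℂ] 𝓔.V.E.Fiber x →L[ℂ] ℂ :=
  -- Over the `j`-th open set, `r` is the `W`-component in the decomposition `i(W) ⊕ h_j(W*)`;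
  -- elsewhere its value is immaterial.
  let r : 𝓔.V.E.Fiber x →L[ℂ] W.E.Fiber x :=
    (ρ x).comp (ContinuousLinearMap.id ℂ _ - (σ.map j x).comp (𝓔.p.map x))
  let q : 𝓔.V.E.Fiber x →L[ℂ] W.E.Fiber x →L[ℂ] ℂ := 𝓔.p.map x
  LinearMap.toContinuousBilin (LinearMap.mk₂ ℂ
    (fun v w => q v (r w) + k.sign * q w (r v))
    (fun v v' w => by simp only [map_add, add_apply]; ring)
    (fun c v w => by
      simp only [map_smul, smul_apply, smul_eq_mul]; ring)
    (fun v w w' => by simp only [map_add, add_apply]; ring)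
    (fun c v w => by
      simp only [map_smul, smul_apply, smul_eq_mul]; ring))

/-- A family of local splittings with skew-symmetric (symmetric) cocycle defines an orthogonal
(symplectic) structure. -/
lemma exists_formStructure (σ : 𝓔.Splitting) (hσ : σ.TakesValuesIn (k.square W)) :
    ∃ α : FormStructure k 𝓔.V, α.IsMaximallyIsotropic 𝓔.i ∧ α.InducesProjection 𝓔 := by
  obtain ⟨ρ, hρi, hiρ⟩ := 𝓔.exists_retraction
  let q : ∀ x, 𝓔.V.E.Fiber x →L[ℂ] W.E.Fiber x →L[ℂ] ℂ := fun x => 𝓔.p.map x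
  let r : ∀ _ x : X, 𝓔.V.E.Fiber x → W.E.Fiber x := fun j x v =>
    ρ x (v - σ.map j x (𝓔.p.map x v))
  have hg : ∀ j x v w, σ.glue k ρ j x v w = q x v (r j x w) + k.sign * q x w (r j x v) :=
    fun _ _ _ _ => rfl
  have hr : ∀ j, ∀ x ∈ σ.cover.set j, ∀ v,
      𝓔.i.map x (r j x v) = v - σ.map j x (𝓔.p.map x v) := fun j x hx v =>
    hiρ x _ (by rw [map_sub, σ.p_map j x hx, sub_self])
  have hri : ∀ j x a, r j x (𝓔.i.map x a) = a := fun j x a => by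
    simp only [r, 𝓔.p_i, map_zero, sub_zero, hρi]
  have hqi : ∀ x a, q x (𝓔.i.map x a) = 0 := 𝓔.p_i
  -- The components satisfy `r_j = r_l + s ∘ q`, so the two forms differ by `q v (s (q w)) + ε q w
  -- (s (q v))`, which vanishes because `s` lies in the square.
  have hglue : ∀ j l, ∀ x ∈ σ.cover.set j, x ∈ σ.cover.set l → ∀ v w,
      σ.glue k ρ j x v w = σ.glue k ρ l x v w := by
    intro j l x hj hl v w
    obtain ⟨s, hs, h⟩ := hσ.map_sub j l x hj hl
    have h1 : ∀ v, r j x v = r l x v + s (q x v) := fun v => 𝓔.injective x (by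
      rw [map_add, hr j x hj, hr l x hl]
      refine Eq.trans ?_ (congrArg (_ + ·) (h (𝓔.p.map x v)).symm)
      dsimp only
      abel)
    have h2 := (k.mem_square_iff W).1 hs (q x v) (q x w)
    rw [hg, hg, h1, h1, map_add, map_add]
    linear_combination h2
  have hp : ∀ x (v : 𝓔.V.E.Fiber x) (w : W.E.Fiber x),
      q x v w = σ.glue k ρ x x v (𝓔.i.map x w) := fun x v w => by
    rw [hg, hri, hqi, zero_apply, mul_zero, add_zero]
  have hmax : ∀ x v, (∀ a, σ.glue k ρ x x v (𝓔.i.map x a) = 0) ↔ ∃ a, 𝓔.i.map x a = v :=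
    fun x v => by
      rw [← 𝓔.exact]
      simp_rw [← hp]
      exact ⟨fun h => ContinuousLinearMap.ext h, fun h a => DFunLike.congr_fun h a⟩
  have hdec : ∀ x v, v = 𝓔.i.map x (r x x v) + σ.map x x (𝓔.p.map x v) := fun x v => by
    rw [hr x x (σ.cover.mem x), sub_add_cancel]
  -- The cover is indexed by points, so the form at `x` can use the splitting with index `x`. Near
  -- `j` it coincides with the `j`-th form by `hglue`, hence is holomorphic.
  refine ⟨⟨fun x => σ.glue k ρ x x, ?_, fun x v w => ?_, fun x v h => ?_, fun x t v w => ?_⟩,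
    hmax, hp⟩
  · refine HolBundle.isHolOn_of_local fun j _ =>
      ⟨σ.cover.set j, (σ.cover.set j).isOpen, σ.cover.mem j, ?_⟩
    refine HolBundle.IsHolOn.mono ?_ Set.inter_subset_right
    refine HolBundle.IsHolOn.congr (s := fun x => σ.glue k ρ j x) ?_ fun x hx =>
      ContinuousLinearMap.ext fun v => ContinuousLinearMap.ext fun w =>
        hglue x j x (σ.cover.mem x) hx v w
    have hrhol : ∀ V : Set X, IsOpen V → V ⊆ σ.cover.set j → ∀ v : ∀ x, 𝓔.V.E.Fiber x,
        𝓔.V.E.IsHolOn v V → W.E.IsHolOn (fun x => r j x (v x)) V := fun V hV hVU v hv =>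
      𝓔.isHolOn_of_i hV ((hv.sub (HolBundle.isHolOn_apply (A := W.dual.E) (B := 𝓔.V.E)
        ((σ.hol j).mono hVU) (𝓔.p.isHolOn_map hv))).congr fun x hx => hr j x (hVU hx) _)
    have hqhol : ∀ V : Set X, ∀ (v : ∀ x, 𝓔.V.E.Fiber x) (w : ∀ x, W.E.Fiber x),
        𝓔.V.E.IsHolOn v V → W.E.IsHolOn w V →
        (HolBundle.trivialLine X).IsHolOn (fun x => q x (v x) (w x)) V := fun V v w hv hw =>
      HolBundle.isHolOn_apply (A := W.E) (B := HolBundle.trivialLine X) (𝓔.p.isHolOn_map hv) hw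
    refine HolBundle.isHolOn_of_apply (σ.cover.set j).isOpen fun V hV hVU v hv => ?_
    refine HolBundle.isHolOn_of_apply hV fun V' hV' hVV' w hw => ?_
    have hv' := hv.mono hVV'
    have hVU' := hVV'.trans hVU
    exact (hqhol V' _ _ hv' (hrhol V' hV' hVU' w hw)).add
      ((hqhol V' _ _ hw (hrhol V' hV' hVU' v hv')).const_smul k.sign)
  · rw [hg, hg]
    linear_combination (-(q x v (r x x w))) * k.sign_mul_self
  -- Testing against `i(W)` kills the `W*`-component of `v`; testing against vectors with arbitrary
  -- image in `W*` then kills its `W`-component.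
  · have h1 : 𝓔.p.map x v = 0 := (𝓔.exact x v).2 ((hmax x v).1 fun a => h _)
    have h2 : r x x v = 0 := W.E.eq_of_forall_dual fun ξ => by
      obtain ⟨w, hw⟩ := 𝓔.surjective x ξ
      have h3 := h w
      have h4 : q x v = 0 := h1
      have h5 : q x w = ξ := hw
      rw [hg, h4, h5, zero_apply, zero_add] at h3
      rw [map_zero]
      linear_combination k.sign * h3 - ξ (r x x v) * k.sign_mul_self
    rw [hdec x v, h1, h2, map_zero, map_zero, add_zero]
  · obtain ⟨s, hs, h⟩ := hσ.higgs x x (σ.cover.mem x) t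
    have hq : ∀ v w, q x (𝓔.V.Φ x t v) w = -q x v (W.Φ x t w) := fun v w => by
      have h1 : q x (𝓔.V.Φ x t v) = W.dual.Φ x t (𝓔.p.map x v) := 𝓔.p.comm x t v
      rw [h1]
      exact W.dual_apply x t _ w
    -- In the decomposition `i(W) ⊕ h_x(W*)`, `Φ` is block triangular with off-diagonal block `s`.
    -- The diagonal blocks `φ` and `-ᵗφ` cancel in the skewness identity, leaving the symmetry
    -- condition on `s`.
    have hrΦ : ∀ v, r x x (𝓔.V.Φ x t v) = W.Φ x t (r x x v) + s (q x v) := fun v =>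
      𝓔.injective x (by
        rw [map_add, hr x x (σ.cover.mem x), 𝓔.i.comm, hr x x (σ.cover.mem x), map_sub, 𝓔.p.comm]
        refine Eq.trans ?_ (congrArg (_ + ·) (h (𝓔.p.map x v)).symm)
        dsimp only
        abel)
    have h2 := (k.mem_square_iff W).1 hs (q x v) (q x w)
    rw [hg, hg, hq, hq, hrΦ, hrΦ, map_add, map_add]
    linear_combination h2

end Extension.Splitting

/-! ### The correspondence between forms and classes, and its consequences -/

namespace Extension

/-- Both sides amount to the existence of local splittings with cocycle in the square; no change of
extension is needed. -/
lemma exists_formStructure_iff (k : FormKind) (𝓔 : Extension W.dual W) :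
    (∃ α : FormStructure k 𝓔.V, α.IsMaximallyIsotropic 𝓔.i ∧ α.InducesProjection 𝓔) ↔
      𝓔.ClassInSquare k := by
  refine Iff.trans ⟨fun ⟨α, hα, hp⟩ => ?_, fun ⟨σ, hσ⟩ => σ.exists_formStructure hσ⟩
    exists_isClass_iff.symm
  have hiso : ∀ x a b, α.form x (𝓔.i.map x a) (𝓔.i.map x b) = 0 := fun x a b =>
    (hα x _).2 ⟨a, rfl⟩ b
  obtain ⟨σ, hσ⟩ := hp.exists_isotropic_splitting hiso
  exact ⟨σ, hp.takesValuesIn hiso σ hσ⟩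

/-- The projection defined by `α` and `p` have the same kernel, so they differ by an automorphism of
`W*`. This is the transpose of an automorphism of `W`, a scalar `c`, and dividing `α` by `c` makes
it induce `p`. -/
lemma exists_inducing_of_scalar
    (hW : ∀ f : Iso W W, ∃ c : ℂ, ∀ x w, f.toHom.map x w = c • w) {α : FormStructure k 𝓔.V}
    (hα : α.IsMaximallyIsotropic 𝓔.i) :
    ∃ β : FormStructure k 𝓔.V, β.IsMaximallyIsotropic 𝓔.i ∧ β.InducesProjection 𝓔 := by
  obtain ⟨g, hg⟩ := 𝓔.exists_iso_of_exact (α.projection 𝓔.i)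
    (α.extension hα).surjective (α.extension hα).exact
  obtain ⟨f, hf⟩ := g.exists_transpose
  obtain ⟨c, hc⟩ := hW f
  have key : ∀ x v w, α.form x v (𝓔.i.map x w) =
      c * (𝓔.p.map x v : W.E.Fiber x →L[ℂ] ℂ) w := by
    intro x v w
    rw [← α.projection_apply, ← hg, ← hf x w (𝓔.p.map x v), hc]
    exact ContinuousLinearMap.map_smul (𝓔.p.map x v : W.E.Fiber x →L[ℂ] ℂ) c w
  -- An automorphism can be the zero scalar only when all fibres of `W` vanish; then any form
  -- induces `p`.
  by_cases h0 : c = 0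
  · refine ⟨α, hα, fun x v w => ?_⟩
    have hw : w = 0 := by
      rw [← f.left_inv x w, hc, h0, zero_smul, map_zero]
    rw [hw, map_zero, map_zero, map_zero]
  · refine ⟨α.smul c⁻¹ (inv_ne_zero h0), hα.smul _ _, fun x v w => ?_⟩
    rw [α.smul_form, key, inv_mul_cancel_left₀ h0]

end Extension

end HiggsBundle
end

theorem mainTheorem9 {X : Type v} [TopologicalSpace X] [T2Space X] [CompactSpace X]
    [ConnectedSpace X] [ChartedSpace ℂ X] [IsManifold 𝓘(ℂ) ω X]
    (W : HiggsBundle.{u} X) (𝓔 : HiggsBundle.Extension W.dual W) (k : HiggsBundle.FormKind) :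
    ((∃ α : HiggsBundle.FormStructure k 𝓔.V,
        α.IsMaximallyIsotropic 𝓔.i ∧ α.InducesProjection 𝓔) ↔
      ∃ 𝓔' : HiggsBundle.Extension W.dual W, 𝓔.StronglyEquivalent 𝓔' ∧ 𝓔'.ClassInSquare k) ∧
    ((∃ α : HiggsBundle.FormStructure k 𝓔.V, α.IsMaximallyIsotropic 𝓔.i) ↔
      ∃ 𝓔' : HiggsBundle.Extension W.dual W, 𝓔.WeaklyEquivalent 𝓔' ∧ 𝓔'.ClassInSquare k) ∧
    ((∀ f : HiggsBundle.Iso W W, ∃ c : ℂ, ∀ x w, f.toHom.map x w = c • w) →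
      ((∃ α : HiggsBundle.FormStructure k 𝓔.V, α.IsMaximallyIsotropic 𝓔.i) ↔
        ∃ 𝓔' : HiggsBundle.Extension W.dual W,
          𝓔.StronglyEquivalent 𝓔' ∧ 𝓔'.ClassInSquare k)) := by
  have weak : (∃ 𝓔' : HiggsBundle.Extension W.dual W,
      𝓔.WeaklyEquivalent 𝓔' ∧ 𝓔'.ClassInSquare k) →
      ∃ α : HiggsBundle.FormStructure k 𝓔.V, α.IsMaximallyIsotropic 𝓔.i := by
    rintro ⟨𝓔', ⟨f, g, F, hi, -⟩, hc⟩
    obtain ⟨α, hα, -⟩ := (𝓔'.exists_formStructure_iff k).2 hc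
    exact ⟨α.pullback F, hα.pullback hi⟩
  have strong := fun h => (𝓔.exists_formStructure_iff k).1 h
  refine ⟨⟨fun h => ⟨𝓔, .refl 𝓔, strong h⟩, ?_⟩, ⟨?_, weak⟩, fun hW => ⟨?_, ?_⟩⟩
  · rintro ⟨𝓔', ⟨F, hi, hp⟩, hc⟩
    obtain ⟨α, hα, hαp⟩ := (𝓔'.exists_formStructure_iff k).2 hc
    exact ⟨α.pullback F, hα.pullback (f := HiggsBundle.Iso.refl W) hi, hαp.pullback hi hp⟩
  · rintro ⟨α, hα⟩
    obtain ⟨g, hg⟩ := 𝓔.exists_iso_of_exact (α.projection 𝓔.i)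
      (α.extension hα).surjective (α.extension hα).exact
    -- Keep `V` and `i` and take the projection defined by `α`: the identity of `V` is a weak
    -- equivalence covering the automorphism `g` of `W*`, and `α` induces the new projection by
    -- construction.
    refine ⟨α.extension hα, ⟨.refl W, g, .refl 𝓔.V, fun _ _ => rfl, fun x v => (hg x v).symm⟩, ?_⟩
    exact ((α.extension hα).exists_formStructure_iff k).1 ⟨α, hα, fun _ _ _ => rfl⟩
  · rintro ⟨α, hα⟩
    exact ⟨𝓔, .refl 𝓔, strong (HiggsBundle.Extension.exists_inducing_of_scalar hW hα)⟩
  · rintro ⟨𝓔', h, hc⟩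
    exact weak ⟨𝓔', h.weaklyEquivalent, hc⟩
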